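/- Let $(M,w)$ be a (smooth, finite-dimensional, Hausdorff) Poisson manifold with bracket $\{f,g\}=w(df,dg)$, let $\sharp:T^*M\to TM$ be given by $\beta(\sharp\alpha)=w(\alpha,\beta)$, and let $X_f=\sharp\,df$ be the Hamiltonian vector field of $f\in C^\infty(M)$. Let $\nabla$ be a smooth linear connection on $M$, with $\nabla_{\partial_i}\partial_j=\Gamma^k_{ij}\partial_k$ in local coordinates $(x^i)$ and curvature $R_\nabla(X,Y)Z=\nabla_X\nabla_YZ-\nabla_Y\nabla_XZ-\nabla_{[X,Y]}Z$. On $T^*M$, with the induced coordinates $(x^i,p_i)$, consider the nonlinear connection defined by $\nabla$, i.e. the horizontal distribution spanned by $$\frac{\delta}{\delta x^i}=\frac{\partial}{\partial x^i}-N_{ij}\frac{\partial}{\partial p_j},\qquad N_{ij}=-p_k\Gamma^k_{ij},$$ and the horizontal lift of $w=\frac12 w^{ij}\,\frac{\partial}{\partial x^i}\wedge\frac{\partial}{\partial x^j}$, i.e. the bivector field $$w^H=\frac12\,w^{ij}(x)\,\frac{\delta}{\delta x^i}\wedge\frac{\delta}{\delta x^j}$$ on $T^*M$. Let $D_\alpha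 Z=\nabla_{\sharp\alpha}Z$ ($\alpha$ a $1$-form, $Z$ a vector field on $M$) be the contravariant connection on $TM$ induced by $\nabla$, with curvature $C_D(\alpha,\beta)Z=D_\alpha D_\beta Z-D_\beta D_\alpha Z-D_{[\alpha,\beta]_w}Z$, where $[\alpha,\beta]_w=L_{\sharp\alpha}\beta-L_{\sharp\beta}\alpha-d(w(\alpha,\beta))$. Then $w^H$ is a Poisson structure on $T^*M$ if and only if $C_D=0$, i.e. $C_D(\alpha,\beta)Z=0$ for all smooth $1$-forms $\alpha,\beta$ and all smooth vector fields $Z$ on $M$. Equivalently, $w^H$ is a Poisson structure on $T^*M$ if and only if $R_\nabla(X_f,X_g)Z=0$ for all $f,g\in C^\infty(M)$ and all smooth vector fields $Z$ on $M$. -/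

import Mathlib

open Bundle Manifold ContDiff

noncomputable section

/-! ### Bivector fields and Poisson structures on an arbitrary manifold -/

section Poisson

variable {E : Type*} [NormedAddCommGroup E] [NormedSpace ℝ E]
  {H : Type*} [TopologicalSpace H] (I : ModelWithCorners ℝ E H)
  (N : Type*) [TopologicalSpace N] [ChartedSpace H N]

/-- A field of bilinear forms on the cotangent spaces of `N`, i.e. a (not necessarily smooth or
skew-symmetric) 2-contravariant tensor field. -/
abbrev ContravariantTwoTensor : Type _ :=
  ∀ x : N, (TangentSpace I x →L[ℝ] ℝ) →ₗ[ℝ] (TangentSpace I x →L[ℝ] ℝ) →ₗ[ℝ] ℝ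

variable {I N}

namespace ContravariantTwoTensor

/-- The bracket `{f, g} = W(df, dg)` of functions defined by `W`. -/
def bracket (W : ContravariantTwoTensor I N) (f g : N → ℝ) : N → ℝ :=
  fun x => W x (mvfderiv I f x) (mvfderiv I g x)

/-- `W` is a smooth bivector field: it is skew-symmetric, and `W(df, dg)` is smooth for all
smooth functions `f`, `g` on `N`. -/
structure IsBivectorField (W : ContravariantTwoTensor I N) : Prop where
  alternating : ∀ (x : N) (α : TangentSpace I x →L[ℝ] ℝ), W x α α = 0
  smooth : ∀ f g : N → ℝ, ContMDiff I 𝓘(ℝ, ℝ) ∞ f → ContMDiff I 𝓘(ℝ, ℝ) ∞ g →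
    ContMDiff I 𝓘(ℝ, ℝ) ∞ (W.bracket f g)

/-- `W` is a Poisson structure: it is a smooth bivector field whose bracket on smooth functions
satisfies the Jacobi identity. -/
structure IsPoisson (W : ContravariantTwoTensor I N) : Prop extends IsBivectorField W where
  jacobi : ∀ f g h : N → ℝ, ContMDiff I 𝓘(ℝ, ℝ) ∞ f → ContMDiff I 𝓘(ℝ, ℝ) ∞ g →
    ContMDiff I 𝓘(ℝ, ℝ) ∞ h →
    W.bracket (W.bracket f g) h + W.bracket (W.bracket g h) f + W.bracket (W.bracket h f) g = 0

end ContravariantTwoTensor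

end Poisson

/-! ### The base manifold `M`: sharp map, bracket of 1-forms, curvatures -/

section Base

variable {E : Type*} [NormedAddCommGroup E] [NormedSpace ℝ E] [FiniteDimensional ℝ E]
  {M : Type*} [TopologicalSpace M] [ChartedSpace E M]

instance tangentSpaceFiniteDimensional (x : M) :
    FiniteDimensional ℝ (TangentSpace 𝓘(ℝ, E) x) :=
  inferInstanceAs (FiniteDimensional ℝ E)

instance tangentSpaceT2Space (x : M) : T2Space (TangentSpace 𝓘(ℝ, E) x) :=
  inferInstanceAs (T2Space E)

/-- The cotangent space `T*_x M`. -/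
abbrev CotangentSpace (E : Type*) [NormedAddCommGroup E] [NormedSpace ℝ E]
    {M : Type*} [TopologicalSpace M] [ChartedSpace E M] (x : M) : Type _ :=
  TangentSpace 𝓘(ℝ, E) x →L[ℝ] Bundle.Trivial M ℝ x

/-- The sharp map `♯ : T*_x M → T_x M` of `w`. It is characterized by `β (♯ α) = w(α, β)`,
see `ContravariantTwoTensor.apply_sharp`; the formula below is `♯ α = ∑ i, w(α, eⁱ) eᵢ`
for a basis `(eᵢ)` of `T_x M` with dual basis `(eⁱ)`. -/
def ContravariantTwoTensor.sharp (w : ContravariantTwoTensor 𝓘(ℝ, E) M) (x : M)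
    (α : CotangentSpace E x) : TangentSpace 𝓘(ℝ, E) x :=
  let b := Module.finBasis ℝ (TangentSpace 𝓘(ℝ, E) x)
  ∑ i, w x α (LinearMap.toContinuousLinearMap (b.coord i)) • b i

theorem ContravariantTwoTensor.apply_sharp (w : ContravariantTwoTensor 𝓘(ℝ, E) M) (x : M)
    (α β : CotangentSpace E x) : β (w.sharp x α) = w x α β := by
  set b := Module.finBasis ℝ (TangentSpace 𝓘(ℝ, E) x) with hb
  have hβ : β = ∑ i, β (b i) • LinearMap.toContinuousLinearMap (b.coord i) := by
    refine ContinuousLinearMap.coe_injective (b.ext fun j => ?_)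
    simp [Finsupp.single_apply]
  conv_rhs => rw [hβ]
  simp only [sharp, map_sum, map_smul, smul_eq_mul]
  exact Finset.sum_congr rfl fun i _ => mul_comm _ _

/-- The Hamiltonian vector field `X_f = ♯ df` of the function `f`. -/
def ContravariantTwoTensor.hamiltonian (w : ContravariantTwoTensor 𝓘(ℝ, E) M) (f : M → ℝ) :
    ∀ x : M, TangentSpace 𝓘(ℝ, E) x :=
  fun x => w.sharp x (mvfderiv 𝓘(ℝ, E) f x)

variable [IsManifold 𝓘(ℝ, E) ∞ M]

/-- Smoothness of a vector field on `M`. -/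
def IsSmoothVectorField (Z : ∀ x : M, TangentSpace 𝓘(ℝ, E) x) : Prop :=
  ContMDiff 𝓘(ℝ, E) (𝓘(ℝ, E).prod 𝓘(ℝ, E)) ∞
    (fun x => TotalSpace.mk' E x (Z x) : M → TangentBundle 𝓘(ℝ, E) M)

/-- Smoothness of a 1-form on `M`. -/
def IsSmoothOneForm (α : ∀ x : M, CotangentSpace E x) : Prop :=
  ContMDiff 𝓘(ℝ, E) (𝓘(ℝ, E).prod 𝓘(ℝ, E →L[ℝ] ℝ)) ∞
    (fun x => TotalSpace.mk' (E →L[ℝ] ℝ) x (α x) :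
      M → TotalSpace (E →L[ℝ] ℝ) (CotangentSpace E : M → Type _))

/-- The value at `x` of the Lie derivative `(L_X β)(Z) = X(β(Z)) - β([X, Z])`. -/
def lieDerivOneForm (X : ∀ x : M, TangentSpace 𝓘(ℝ, E) x) (β : ∀ x : M, CotangentSpace E x)
    (x : M) (Z : ∀ x : M, TangentSpace 𝓘(ℝ, E) x) : ℝ :=
  mvfderiv 𝓘(ℝ, E) (fun y => (β y (Z y) : ℝ)) x (X x)
    - β x (VectorField.mlieBracket 𝓘(ℝ, E) X Z x)

/-- The value at `x` of `(L_{♯α} β - L_{♯β} α - d(w(α, β)))(Z)`. -/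
def oneFormBracketAux (w : ContravariantTwoTensor 𝓘(ℝ, E) M)
    (α β : ∀ x : M, CotangentSpace E x) (x : M) (Z : ∀ x : M, TangentSpace 𝓘(ℝ, E) x) : ℝ :=
  lieDerivOneForm (fun y => w.sharp y (α y)) β x Z
    - lieDerivOneForm (fun y => w.sharp y (β y)) α x Z
    - mvfderiv 𝓘(ℝ, E) (fun y => w y (α y) (β y)) x (Z x)

theorem lieDerivOneForm_tensorialAt (X : ∀ x : M, TangentSpace 𝓘(ℝ, E) x)
    {β : ∀ x : M, CotangentSpace E x} (hβ : IsSmoothOneForm β) (x : M) :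
    TensorialAt 𝓘(ℝ, E) E (lieDerivOneForm X β x) x := by
  have : CompleteSpace E := FiniteDimensional.complete ℝ E
  have hβ' := (hβ x).mdifferentiableAt (by simp)
  have key : ∀ {σ : ∀ x : M, TangentSpace 𝓘(ℝ, E) x}, MDiffAt (T% σ) x →
      MDifferentiableAt 𝓘(ℝ, E) 𝓘(ℝ, ℝ) (fun y => (β y (σ y) : ℝ)) x := by
    intro σ hσ
    have h := (mdifferentiableAt_totalSpace _ _).1 (hβ'.clm_bundle_apply hσ)
    simpa using h.2
  constructor
  · intro f σ hf hσ
    have h1 : (fun y => (β y ((f • σ) y) : ℝ)) = f * fun y => (β y (σ y) : ℝ) := by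
      ext y; simp
    simp only [lieDerivOneForm]
    rw [h1, mvfderiv_mul hf (key hσ), VectorField.mlieBracket_smul_right hf hσ]
    simp only [map_add, map_smul, add_apply, smul_apply,
      smul_eq_mul]
    ring
  · intro σ σ' hσ hσ'
    have h1 : (fun y => (β y ((σ + σ') y) : ℝ)) =
        (fun y => (β y (σ y) : ℝ)) + fun y => (β y (σ' y) : ℝ) := by
      ext y; simp
    simp only [lieDerivOneForm]
    rw [h1, mvfderiv_add (key hσ) (key hσ'), VectorField.mlieBracket_add_right hσ hσ']
    simp only [map_add, add_apply]
    ring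

/-- The bracket of 1-forms on `(M, w)`: for smooth `α`, `β` it is the 1-form
`L_{♯α} β - L_{♯β} α - d(w(α, β))`, see `oneFormBracket_apply`. -/
def oneFormBracket (w : ContravariantTwoTensor 𝓘(ℝ, E) M)
    (α β : ∀ x : M, CotangentSpace E x) (x : M) : CotangentSpace E x :=
  open Classical in
  if h : TensorialAt 𝓘(ℝ, E) E (oneFormBracketAux w α β x) x then
    TensorialAt.mkHom (oneFormBracketAux w α β x) x h
  else 0

theorem oneFormBracketAux_tensorialAt (w : ContravariantTwoTensor 𝓘(ℝ, E) M)
    {α β : ∀ x : M, CotangentSpace E x} (hα : IsSmoothOneForm α) (hβ : IsSmoothOneForm β) (x : M) :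
    TensorialAt 𝓘(ℝ, E) E (oneFormBracketAux w α β x) x := by
  have h1 := lieDerivOneForm_tensorialAt (fun y => w.sharp y (α y)) hβ x
  have h2 := lieDerivOneForm_tensorialAt (fun y => w.sharp y (β y)) hα x
  constructor
  · intro f σ hf hσ
    simp only [oneFormBracketAux, h1.smul hf hσ, h2.smul hf hσ, Pi.smul_apply', map_smul]
    simp only [smul_eq_mul]; ring
  · intro σ σ' hσ hσ'
    simp only [oneFormBracketAux, h1.add hσ hσ', h2.add hσ hσ', Pi.add_apply, map_add]
    ring

theorem oneFormBracket_apply (w : ContravariantTwoTensor 𝓘(ℝ, E) M)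
    {α β : ∀ x : M, CotangentSpace E x} (hα : IsSmoothOneForm α) (hβ : IsSmoothOneForm β)
    {Z : ∀ x : M, TangentSpace 𝓘(ℝ, E) x} (hZ : IsSmoothVectorField Z) (x : M) :
    oneFormBracket w α β x (Z x) =
      lieDerivOneForm (fun y => w.sharp y (α y)) β x Z
        - lieDerivOneForm (fun y => w.sharp y (β y)) α x Z
        - mvfderiv 𝓘(ℝ, E) (fun y => w y (α y) (β y)) x (Z x) := by
  have h := oneFormBracketAux_tensorialAt w hα hβ x
  rw [oneFormBracket, dif_pos h]
  exact h.mkHom_apply ((hZ x).mdifferentiableAt (by simp))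

/-- A linear connection on `M`, in the order of arguments of Mathlib:
`nabla Z x v` is `∇_v Z` at `x`. -/
abbrev LinearConnection (E : Type*) [NormedAddCommGroup E] [NormedSpace ℝ E]
    (M : Type*) [TopologicalSpace M] [ChartedSpace E M] [IsManifold 𝓘(ℝ, E) ∞ M] : Type _ :=
  CovariantDerivative 𝓘(ℝ, E) E (TangentSpace 𝓘(ℝ, E) : M → Type _)

/-- The vector field `∇_X Z`. -/
def LinearConnection.deriv (nabla : LinearConnection E M) (X Z : ∀ x : M, TangentSpace 𝓘(ℝ, E) x) :
    ∀ x : M, TangentSpace 𝓘(ℝ, E) x :=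
  fun x => nabla Z x (X x)

/-- The curvature `R_∇(X, Y)Z = ∇_X ∇_Y Z - ∇_Y ∇_X Z - ∇_[X, Y] Z`. -/
def LinearConnection.curvature (nabla : LinearConnection E M)
    (X Y Z : ∀ x : M, TangentSpace 𝓘(ℝ, E) x) : ∀ x : M, TangentSpace 𝓘(ℝ, E) x :=
  nabla.deriv X (nabla.deriv Y Z) - nabla.deriv Y (nabla.deriv X Z)
    - nabla.deriv (VectorField.mlieBracket 𝓘(ℝ, E) X Y) Z

/-- The contravariant connection `D_α Z = ∇_{♯α} Z` on `TM` induced by `∇` on `(M, w)`. -/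
def LinearConnection.contravariant (nabla : LinearConnection E M)
    (w : ContravariantTwoTensor 𝓘(ℝ, E) M)
    (α : ∀ x : M, CotangentSpace E x) (Z : ∀ x : M, TangentSpace 𝓘(ℝ, E) x) :
    ∀ x : M, TangentSpace 𝓘(ℝ, E) x :=
  nabla.deriv (fun x => w.sharp x (α x)) Z

/-- The curvature `C_D(α, β)Z = D_α D_β Z - D_β D_α Z - D_[α, β] Z` of a contravariant
connection `D` on `TM`, where `(M, w)` is a Poisson manifold and `[α, β]` is the bracket
of 1-forms defined by `w`. -/
def contravariantCurvature (w : ContravariantTwoTensor 𝓘(ℝ, E) M)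
    (D : (∀ x : M, CotangentSpace E x) → (∀ x : M, TangentSpace 𝓘(ℝ, E) x) →
      ∀ x : M, TangentSpace 𝓘(ℝ, E) x)
    (α β : ∀ x : M, CotangentSpace E x) (Z : ∀ x : M, TangentSpace 𝓘(ℝ, E) x) :
    ∀ x : M, TangentSpace 𝓘(ℝ, E) x :=
  D α (D β Z) - D β (D α Z) - D (oneFormBracket w α β) Z

/-! ### The cotangent bundle and horizontal lifts -/

/-- The total space of the cotangent bundle `T*M`. It is a manifold through the charts
`(x, p) ↦ (xⁱ, pᵢ)` induced by the charts of `M`. -/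
abbrev CotangentBundle (E : Type*) [NormedAddCommGroup E] [NormedSpace ℝ E]
    (M : Type*) [TopologicalSpace M] [ChartedSpace E M] : Type _ :=
  TotalSpace (E →L[ℝ] ℝ) (CotangentSpace E : M → Type _)

/-- The model with corners of the manifold `T*M`. -/
abbrev cotangentModel (E : Type*) [NormedAddCommGroup E] [NormedSpace ℝ E] :
    ModelWithCorners ℝ (E × (E →L[ℝ] ℝ)) (ModelProd E (E →L[ℝ] ℝ)) :=
  𝓘(ℝ, E).prod 𝓘(ℝ, E →L[ℝ] ℝ)

/-- The momentum `m(Z) : T*M → ℝ`, `m(Z)(x, p) = p(Z x)` of a vector field `Z`. -/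
def momentum (Z : ∀ x : M, TangentSpace 𝓘(ℝ, E) x) : CotangentBundle E M → ℝ :=
  fun u => u.2 (Z u.1)

/-- The coordinate vector field with constant components `e` in the preferred chart at `x₀`
(it is only relevant near `x₀`, and is set to `0` outside the domain of that chart). -/
def coordVectorField (x₀ : M) (e : E) : ∀ x : M, TangentSpace 𝓘(ℝ, E) x :=
  fun x => (trivializationAt E (TangentSpace 𝓘(ℝ, E) : M → Type _) x₀).symmL ℝ x e

theorem coordVectorField_mdifferentiableAt (x₀ : M) (e : E) :
    MDiffAt (T% (coordVectorField x₀ e)) x₀ := by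
  have hx : x₀ ∈ (trivializationAt E (TangentSpace 𝓘(ℝ, E) : M → Type _) x₀).baseSet :=
    FiberBundle.mem_baseSet_trivializationAt' x₀
  rw [mdifferentiableAt_section]
  refine (mdifferentiableAt_const (c := e)).congr_of_eventuallyEq ?_
  filter_upwards [(trivializationAt E (TangentSpace 𝓘(ℝ, E) : M → Type _) x₀).open_baseSet.mem_nhds
    hx] with y hy
  have h := (trivializationAt E (TangentSpace 𝓘(ℝ, E) : M → Type _) x₀).continuousLinearMapAt_symmL
    (R := ℝ) hy e
  rwa [Trivialization.continuousLinearMapAt_apply, Trivialization.linearMapAt_apply, if_pos hy] at h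

/-- For a covector `u` at `x` and `v ∈ T_x M`, the covector `e ↦ u(∇_v ∂_e)`, where `∂_e` is the
coordinate vector field with components `e` in the preferred chart at `x`.
In components this is `pₖ Γᵏᵢⱼ vⁱ dxʲ = - Nᵢⱼ vⁱ dxʲ`, where `∇_∂ᵢ ∂ⱼ = Γᵏᵢⱼ ∂ₖ`. -/
def verticalPart (nabla : LinearConnection E M) (u : CotangentBundle E M) :
    TangentSpace 𝓘(ℝ, E) u.1 →ₗ[ℝ] (E →L[ℝ] ℝ) where
  toFun v := LinearMap.toContinuousLinearMap
    { toFun := fun e => u.2 (nabla (coordVectorField u.1 e) u.1 v)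
      map_add' := fun e e' => by
        have h : coordVectorField u.1 (e + e') = coordVectorField u.1 e + coordVectorField u.1 e' := by
          funext y; exact map_add _ e e'
        rw [h, nabla.isCovariantDerivativeOnUniv.add (coordVectorField_mdifferentiableAt u.1 e)
          (coordVectorField_mdifferentiableAt u.1 e')]
        exact map_add u.2 _ _
      map_smul' := fun c e => by
        have h : coordVectorField u.1 (c • e) = c • coordVectorField u.1 e := by
          funext y; exact map_smul _ c e
        rw [h, nabla.isCovariantDerivativeOnUniv.smul_const c
          (coordVectorField_mdifferentiableAt u.1 e)]
        exact map_smul u.2 _ _ }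
  map_add' v v' := by
    ext e
    change u.2 (nabla (coordVectorField u.1 e) u.1 (v + v')) = _
    rw [map_add, map_add]; rfl
  map_smul' c v := by
    ext e
    change u.2 (nabla (coordVectorField u.1 e) u.1 (c • v)) = _
    rw [map_smul, map_smul]; rfl

/-- The horizontal lift `T_x M → T_u (T*M)` at `u ∈ T*_x M` of the connection on `T*M` defined
by `∇`: in the natural coordinates of `T*M` it maps
`∂/∂xⁱ` to `δ/δxⁱ = ∂/∂xⁱ - Nᵢⱼ ∂/∂pⱼ` with `Nᵢⱼ = - pₖ Γᵏᵢⱼ`.  -/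
def horizontalLift (nabla : LinearConnection E M) (u : CotangentBundle E M) :
    TangentSpace 𝓘(ℝ, E) u.1 →L[ℝ] TangentSpace (cotangentModel E) u :=
  LinearMap.toContinuousLinearMap
    ((LinearMap.prod LinearMap.id (verticalPart nabla u) :
      TangentSpace 𝓘(ℝ, E) u.1 →ₗ[ℝ] E × (E →L[ℝ] ℝ)))

/-- The horizontal lift `w^H = ½ wⁱʲ δ/δxⁱ ∧ δ/δxʲ` of `w` to `T*M` with respect to `∇`. -/
def horizontalLiftTensor (nabla : LinearConnection E M) (w : ContravariantTwoTensor 𝓘(ℝ, E) M) :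
    ContravariantTwoTensor (cotangentModel E) (CotangentBundle E M) :=
  fun u => (w u.1).compl₁₂
    (ContinuousLinearMap.precomp ℝ (horizontalLift nabla u)).toLinearMap
    (ContinuousLinearMap.precomp ℝ (horizontalLift nabla u)).toLinearMap

end Base

end

/-!
The differential of a function on `T*M` at a point is determined by those of base functions `f ∘ π`
and momenta `m(Z)`, on which the bracket of `w^H` is `{f ∘ π, g ∘ π} = {f, g} ∘ π` and
`{f ∘ π, m(Z)} = m(∇_{X_f} Z)`. Hence the Jacobiator vanishes on three base functions, and on
`(f ∘ π, g ∘ π, m(Z))` it is `-m(R(X_f, X_g) Z)`, because `[X_f, X_g] = X_{{f, g}}`. This is the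
curvature condition. Conversely, `w^H` only sees the horizontal part of a differential, and near
each point it is a sum of tensor products of smooth horizontal fields. So if `F` and `G` have
vanishing horizontal differential at `u`, then `{F, G}` has vanishing differential at `u`, and every
Jacobiator containing both `F` and `G` vanishes there. Subtracting base functions gives any function
a vanishing horizontal differential at `u`, so Jacobiators with at least two base functions decide
everything.

Since `♯[α, β]_w = [♯α, ♯β]`, the contravariant curvature is `C_D(α, β) = R(♯α, ♯β)`, and by
tensoriality it suffices to test it on exact forms.
-/

section Calculus

open Set Filter Topology VectorField

variable {E : Type*} [NormedAddCommGroup E] [NormedSpace ℝ E]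

theorem fderiv_lieBracket {F : Type*} [NormedAddCommGroup F] [NormedSpace ℝ F] {f : E → F}
    {V W : E → E} {x : E} (hf : ContDiffAt ℝ 2 f x) (hV : DifferentiableAt ℝ V x)
    (hW : DifferentiableAt ℝ W x) :
    fderiv ℝ f x (lieBracket ℝ V W x) =
      fderiv ℝ (fun y => fderiv ℝ f y (W y)) x (V x) -
        fderiv ℝ (fun y => fderiv ℝ f y (V y)) x (W x) := by
  have hdf : DifferentiableAt ℝ (fderiv ℝ f) x :=
    (hf.fderiv_right (m := 1) (by norm_num)).differentiableAt (by simp)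
  have hsymm := (hf.isSymmSndFDerivAt (by simp)).eq (V x) (W x)
  simp [lieBracket, fderiv_clm_apply hdf hV, fderiv_clm_apply hdf hW, hsymm]

variable {H : Type*} [TopologicalSpace H] {I : ModelWithCorners ℝ E H}
  {N : Type*} [TopologicalSpace N] [ChartedSpace H N]

theorem mvfderiv_congr_of_eventuallyEq {f g : N → ℝ} {x : N} (h : f =ᶠ[𝓝 x] g) :
    mvfderiv I f x = mvfderiv I g x := by
  unfold mvfderiv
  rw [h.mfderiv_eq]
  rfl

variable [IsManifold I ∞ N]

theorem mvfderiv_clm_comp_extChartAt {x₀ x : N} (l : E →L[ℝ] ℝ) (hx : x ∈ (chartAt H x₀).source)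
    (v : TangentSpace I x) :
    mvfderiv I (fun y => l (extChartAt I x₀ y)) x v =
      l (mfderiv I 𝓘(ℝ, E) (extChartAt I x₀) x v) := by
  have := mvfderiv_comp_apply (I' := I) (I := 𝓘(ℝ, E)) x
    l.differentiableAt.mdifferentiableAt (mdifferentiableAt_extChartAt (I := I) hx) v
  refine this.trans ?_
  rw [mvfderiv, mfderiv_eq_fderiv, l.fderiv]
  rfl

theorem contMDiff_tangentBundle_mvfderiv {f : N → ℝ} (hf : ContMDiff I 𝓘(ℝ, ℝ) ∞ f) :
    ContMDiff I.tangent 𝓘(ℝ, ℝ) ∞ fun v : TangentBundle I N => mvfderiv I f v.1 v.2 :=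
  (contMDiff_snd_tangentBundle_modelSpace ℝ 𝓘(ℝ, ℝ)).comp (hf.contMDiff_tangentMap (by simp))

theorem contMDiffAt_mvfderiv_apply {f : N → ℝ} {V : ∀ x : N, TangentSpace I x} {x₀ : N}
    (hf : ContMDiff I 𝓘(ℝ, ℝ) ∞ f) (hV : ContMDiffAt I I.tangent ∞ (T% V) x₀) :
    ContMDiffAt I 𝓘(ℝ, ℝ) ∞ (fun x => mvfderiv I f x (V x)) x₀ :=
  ContMDiffAt.comp x₀ (contMDiff_tangentBundle_mvfderiv hf _) hV

theorem mdifferentiableAt_mvfderiv_apply {f : N → ℝ} {V : ∀ x : N, TangentSpace I x}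
    {x₀ : N} (hf : ContMDiff I 𝓘(ℝ, ℝ) ∞ f) (hV : MDifferentiableAt I I.tangent (T% V) x₀) :
    MDifferentiableAt I 𝓘(ℝ, ℝ) (fun x => mvfderiv I f x (V x)) x₀ :=
  MDifferentiableAt.comp x₀ ((contMDiff_tangentBundle_mvfderiv hf _).mdifferentiableAt (by simp)) hV

theorem eventually_trivializationAt_snd_eq (V : ∀ x : N, TangentSpace I x) (x₀ : N) :
    ∀ᶠ x in 𝓝 x₀, (trivializationAt E (TangentSpace I : N → Type _) x₀ ⟨x, V x⟩).2 =
      mfderiv I 𝓘(ℝ, E) (extChartAt I x₀) x (V x) := by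
  filter_upwards [(chartAt H x₀).open_source.mem_nhds (mem_chart_source H x₀)] with x hx
  have hx' : x ∈ (trivializationAt E (TangentSpace I : N → Type _) x₀).baseSet := by simpa using hx
  have hsnd := congrFun (Trivialization.continuousLinearMapAt_apply ℝ
    (trivializationAt E (TangentSpace I : N → Type _) x₀) (b := x)) (V x)
  rw [Trivialization.linearMapAt_apply, if_pos hx'] at hsnd
  exact hsnd.symm.trans
    (DFunLike.congr_fun (TangentBundle.continuousLinearMapAt_trivializationAt hx) (V x))

section FiniteDimensional

variable [FiniteDimensional ℝ E]

theorem exists_contMDiff_eventuallyEq [T2Space N] (x₀ : N) {g : N → ℝ}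
    (hg : ContMDiffOn I 𝓘(ℝ, ℝ) ∞ g (chartAt H x₀).source) :
    ∃ f : N → ℝ, ContMDiff I 𝓘(ℝ, ℝ) ∞ f ∧ f =ᶠ[𝓝 x₀] g := by
  obtain ⟨χ⟩ : Nonempty (SmoothBumpFunction I x₀) := inferInstance
  refine ⟨fun x => χ x • g x, χ.contMDiff_smul hg, ?_⟩
  filter_upwards [χ.eventuallyEq_one] with x hx
  simp [hx]

theorem exists_contMDiff_eventuallyEq_extChartAt [T2Space N] (x₀ : N) (l : E →L[ℝ] ℝ) :
    ∃ f : N → ℝ, ContMDiff I 𝓘(ℝ, ℝ) ∞ f ∧ f =ᶠ[𝓝 x₀] fun x => l (extChartAt I x₀ x) :=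
  exists_contMDiff_eventuallyEq x₀
    (l.contDiff.contMDiff.comp_contMDiffOn (contMDiffOn_extChartAt (I := I) (x := x₀)))

theorem exists_mvfderiv_eq [T2Space N] (x : N) (a : TangentSpace I x →L[ℝ] ℝ) :
    ∃ f : N → ℝ, ContMDiff I 𝓘(ℝ, ℝ) ∞ f ∧ mvfderiv I f x = a := by
  obtain ⟨A, hA⟩ := isInvertible_mfderiv_extChartAt (I := I) (mem_extChartAt_source (I := I) x)
  obtain ⟨f, hf, hfe⟩ :=
    exists_contMDiff_eventuallyEq_extChartAt (I := I) x (a ∘L A.symm.toContinuousLinearMap)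
  refine ⟨f, hf, ?_⟩
  ext v
  rw [mvfderiv_congr_of_eventuallyEq hfe, mvfderiv_clm_comp_extChartAt _ (mem_chart_source H x),
    ← hA]
  exact congrArg a (A.symm_apply_apply v)

theorem eq_of_forall_mvfderiv_eq [T2Space N] {x : N} {v v' : TangentSpace I x}
    (h : ∀ f : N → ℝ, ContMDiff I 𝓘(ℝ, ℝ) ∞ f → mvfderiv I f x v = mvfderiv I f x v') :
    v = v' := by
  refine (SeparatingDual.eq_iff_forall_dual_eq (R := ℝ) (V := E)).2 fun a => ?_
  obtain ⟨f, hf, rfl⟩ := exists_mvfderiv_eq (I := I) x a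
  exact h f hf

theorem contMDiffAt_vectorField_of_coordinates {V : ∀ x : N, TangentSpace I x} {x₀ : N}
    (h : ∀ l : E →L[ℝ] ℝ, ∃ f : N → ℝ, f =ᶠ[𝓝 x₀] (fun x => l (extChartAt I x₀ x)) ∧
      ContMDiffAt I 𝓘(ℝ, ℝ) ∞ (fun x => mvfderiv I f x (V x)) x₀) :
    ContMDiffAt I I.tangent ∞ (T% V) x₀ := by
  rw [contMDiffAt_section]
  let b := Module.finBasis ℝ E
  have hcoord : ∀ i, ContMDiffAt I 𝓘(ℝ, ℝ) ∞ (fun x => b.coord i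
      (trivializationAt E (TangentSpace I : N → Type _) x₀ ⟨x, V x⟩).2) x₀ := by
    intro i
    obtain ⟨f, hf, hfV⟩ := h (LinearMap.toContinuousLinearMap (b.coord i))
    refine hfV.congr_of_eventuallyEq ?_
    filter_upwards [eventually_trivializationAt_snd_eq V x₀, hf.eventuallyEq_nhds,
      (chartAt H x₀).open_source.mem_nhds (mem_chart_source H x₀)] with x hx hfx hxs
    rw [hx, mvfderiv_congr_of_eventuallyEq hfx, mvfderiv_clm_comp_extChartAt _ hxs]
    rfl
  refine ContMDiffAt.congr_of_eventuallyEq (contMDiffAt_finsetSum (t := Finset.univ) fun i _ =>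
    (hcoord i).smul (contMDiffAt_const (c := b i))) (Eventually.of_forall fun x => ?_)
  exact (b.sum_repr _).symm

end FiniteDimensional

section LieBracket

/-- The representative of the vector field `U` in the preferred chart at `x`; this is the vector
field on `E` through which Mathlib defines `mlieBracket` at `x`. -/
noncomputable def vectorFieldInChart (x : N) (U : ∀ y : N, TangentSpace I y) : E → E :=
  mpullbackWithin 𝓘(ℝ, E) I (extChartAt I x).symm U (range I)

theorem mfderivWithin_vectorFieldInChart {x : N} (U : ∀ y : N, TangentSpace I y) {y : E}
    (hy : y ∈ (extChartAt I x).target) :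
    mfderivWithin 𝓘(ℝ, E) I (extChartAt I x).symm (range I) y
        (vectorFieldInChart (E := E) x U y) =
      U ((extChartAt I x).symm y) := by
  obtain ⟨B, hB⟩ := isInvertible_mfderivWithin_extChartAt_symm (I := I) hy
  change mfderivWithin 𝓘(ℝ, E) I (extChartAt I x).symm (range I) y
    ((mfderivWithin 𝓘(ℝ, E) I (extChartAt I x).symm (range I) y).inverse _) = _
  rw [← hB, ContinuousLinearMap.inverse_equiv]
  exact B.apply_symm_apply _

theorem vectorFieldInChart_self (x : N) (U : ∀ y : N, TangentSpace I y) :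
    vectorFieldInChart x U (extChartAt I x x) = (U x : E) := by
  have h := mfderivWithin_vectorFieldInChart U (mem_extChartAt_target (I := I) x)
  rw [mfderivWithin_range_extChartAt_symm] at h
  exact h.trans (congrArg (fun z : N => (U z : E)) (extChartAt_to_inv x))

variable [I.Boundaryless]

theorem fderiv_comp_extChartAt_symm {g : N → ℝ} {x : N} {y : E}
    (hy : y ∈ (extChartAt I x).target)
    (hg : MDifferentiableAt I 𝓘(ℝ, ℝ) g ((extChartAt I x).symm y)) (v : E) :
    fderiv ℝ (g ∘ (extChartAt I x).symm) y v = mvfderiv I g ((extChartAt I x).symm y)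
      (mfderivWithin 𝓘(ℝ, E) I (extChartAt I x).symm (range I) y v) := by
  have hsymm := mdifferentiableWithinAt_extChartAt_symm (I := I) hy
  rw [I.range_eq_univ, mdifferentiableWithinAt_univ] at hsymm
  rw [I.range_eq_univ, mfderivWithin_univ, ← mfderiv_eq_fderiv]
  exact mfderiv_comp_apply y hg hsymm v

theorem fderiv_comp_extChartAt_symm_self {g : N → ℝ} {x : N}
    (hg : MDifferentiableAt I 𝓘(ℝ, ℝ) g x) (v : E) :
    fderiv ℝ (g ∘ (extChartAt I x).symm) (extChartAt I x x) v = mvfderiv I g x v := by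
  rw [fderiv_comp_extChartAt_symm (mem_extChartAt_target x) (by rwa [extChartAt_to_inv]),
    mfderivWithin_range_extChartAt_symm]
  exact congrArg (fun z : N => (mvfderiv I g z : E →L[ℝ] ℝ) v) (extChartAt_to_inv x)

theorem differentiableAt_vectorFieldInChart [CompleteSpace E] {U : ∀ y : N, TangentSpace I y}
    {x : N} (hU : MDifferentiableAt I I.tangent (T% U) x) :
    DifferentiableAt ℝ (vectorFieldInChart x U) (extChartAt I x x) := by
  have : IsManifold I 2 N := IsManifold.of_le (n := ∞) (by exact ENat.LEInfty.out)
  have h : DifferentiableWithinAt ℝ (vectorFieldInChart x U)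
      ((extChartAt I x).symm ⁻¹' univ ∩ range I) (extChartAt I x x) :=
    (mdifferentiableWithinAt_univ.2 hU).differentiableWithinAt_mpullbackWithin_vectorField
  rwa [preimage_univ, univ_inter, I.range_eq_univ, differentiableWithinAt_univ] at h

theorem mlieBracket_eq_lieBracket_vectorFieldInChart (V W : ∀ y : N, TangentSpace I y) (x : N) :
    (mlieBracket I V W x : E) =
      lieBracket ℝ (vectorFieldInChart x V) (vectorFieldInChart x W) (extChartAt I x x) := by
  rw [← mlieBracketWithin_univ, mlieBracketWithin_apply, preimage_univ, univ_inter,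
    mfderiv_extChartAt_self, ← lieBracketWithin_univ, ← I.range_eq_univ]
  exact DFunLike.congr_fun (ContinuousLinearMap.inverse_id (R := ℝ) (M := E)) _

theorem mvfderiv_mvfderiv_apply [CompleteSpace E] {f : N → ℝ} (hf : ContMDiff I 𝓘(ℝ, ℝ) ∞ f)
    {U : ∀ y : N, TangentSpace I y} {x : N} (hU : MDifferentiableAt I I.tangent (T% U) x) (v : E) :
    mvfderiv I (fun y => mvfderiv I f y (U y)) x v =
      fderiv ℝ (fun y => fderiv ℝ (f ∘ (extChartAt I x).symm) y (vectorFieldInChart x U y))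
        (extChartAt I x x) v := by
  rw [← fderiv_comp_extChartAt_symm_self (mdifferentiableAt_mvfderiv_apply hf hU)]
  refine DFunLike.congr_fun (EventuallyEq.fderiv_eq ?_) v
  filter_upwards [extChartAt_target_mem_nhds (I := I) x] with y hy
  rw [fderiv_comp_extChartAt_symm hy ((hf _).mdifferentiableAt (by simp)),
    mfderivWithin_vectorFieldInChart U hy]
  rfl

theorem mvfderiv_mlieBracket [CompleteSpace E] {f : N → ℝ} (hf : ContMDiff I 𝓘(ℝ, ℝ) ∞ f)
    {V W : ∀ x : N, TangentSpace I x} {x : N}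
    (hV : MDifferentiableAt I I.tangent (T% V) x) (hW : MDifferentiableAt I I.tangent (T% W) x) :
    mvfderiv I f x (mlieBracket I V W x) =
      mvfderiv I (fun y => mvfderiv I f y (W y)) x (V x) -
        mvfderiv I (fun y => mvfderiv I f y (V y)) x (W x) := by
  have hsymm := contMDiffWithinAt_extChartAt_symm_range (I := I) (n := ∞) x
    (mem_extChartAt_target x)
  rw [I.range_eq_univ, contMDiffWithinAt_univ] at hsymm
  have hfc : ContDiffAt ℝ 2 (f ∘ (extChartAt I x).symm) (extChartAt I x x) :=
    ((hf _).comp _ hsymm).contDiffAt.of_le (by exact ENat.LEInfty.out)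
  have hcomm := fderiv_lieBracket hfc (differentiableAt_vectorFieldInChart hV)
    (differentiableAt_vectorFieldInChart hW)
  rw [← mlieBracket_eq_lieBracket_vectorFieldInChart, vectorFieldInChart_self,
    vectorFieldInChart_self] at hcomm
  calc mvfderiv I f x (mlieBracket I V W x)
      = fderiv ℝ (f ∘ (extChartAt I x).symm) (extChartAt I x x) (mlieBracket I V W x) :=
        (fderiv_comp_extChartAt_symm_self ((hf x).mdifferentiableAt (by simp)) _).symm
    _ = _ := hcomm
    _ = _ := (congrArg₂ (fun a b : ℝ => a - b) (mvfderiv_mvfderiv_apply hf hW (V x))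
        (mvfderiv_mvfderiv_apply hf hV (W x))).symm

end LieBracket

end Calculus

section Jacobiator

open Filter VectorField

variable {E : Type*} [NormedAddCommGroup E] [NormedSpace ℝ E]

theorem exists_forall_apply_eq_of_bidual [FiniteDimensional ℝ E] (L : (E →L[ℝ] ℝ) →ₗ[ℝ] ℝ) :
    ∃ e : E, ∀ c : E →L[ℝ] ℝ, c e = L c :=
  ⟨(Module.evalEquiv ℝ E).symm (L ∘ₗ LinearMap.toContinuousLinearMap.toLinearMap), fun c =>
    Module.apply_evalEquiv_symm_apply ℝ E (c : E →ₗ[ℝ] ℝ) _⟩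

variable {H : Type*} [TopologicalSpace H] {I : ModelWithCorners ℝ E H}
  {N : Type*} [TopologicalSpace N] [ChartedSpace H N]

namespace ContravariantTwoTensor

variable {W : ContravariantTwoTensor I N}

theorem IsBivectorField.skew (hW : W.IsBivectorField) (x : N) (a b : TangentSpace I x →L[ℝ] ℝ) :
    W x a b = -W x b a := by
  have h := hW.alternating x (a + b)
  simp only [map_add, LinearMap.add_apply, hW.alternating] at h
  linarith

theorem IsBivectorField.bracket_swap (hW : W.IsBivectorField) (f g : N → ℝ) :
    W.bracket f g = -W.bracket g f :=
  funext fun _ => hW.skew _ _ _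

theorem bracket_neg_left (f g : N → ℝ) : W.bracket (-f) g = -W.bracket f g := by
  ext x
  simp [bracket, mvfderiv_neg]

theorem bracket_neg_right (f g : N → ℝ) : W.bracket f (-g) = -W.bracket f g := by
  ext x
  simp [bracket, mvfderiv_neg]

theorem bracket_add_left {f f' : N → ℝ} (hf : ContMDiff I 𝓘(ℝ, ℝ) ∞ f)
    (hf' : ContMDiff I 𝓘(ℝ, ℝ) ∞ f') (g : N → ℝ) :
    W.bracket (f + f') g = W.bracket f g + W.bracket f' g := by
  ext x
  simp [bracket, mvfderiv_add ((hf x).mdifferentiableAt (by simp))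
    ((hf' x).mdifferentiableAt (by simp))]

theorem bracket_add_right {g g' : N → ℝ} (hg : ContMDiff I 𝓘(ℝ, ℝ) ∞ g)
    (hg' : ContMDiff I 𝓘(ℝ, ℝ) ∞ g') (f : N → ℝ) :
    W.bracket f (g + g') = W.bracket f g + W.bracket f g' := by
  ext x
  simp [bracket, mvfderiv_add ((hg x).mdifferentiableAt (by simp))
    ((hg' x).mdifferentiableAt (by simp))]

/-- The Jacobiator `{{f, g}, h} + {{g, h}, f} + {{h, f}, g}` of the bracket defined by `W`. -/
noncomputable def jacobiator (W : ContravariantTwoTensor I N) (f g h : N → ℝ) : N → ℝ :=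
  W.bracket (W.bracket f g) h + W.bracket (W.bracket g h) f + W.bracket (W.bracket h f) g

theorem jacobiator_cyclic (f g h : N → ℝ) : W.jacobiator f g h = W.jacobiator g h f := by
  simp only [jacobiator]
  ring

theorem jacobiator_neg_left (f g h : N → ℝ) : W.jacobiator (-f) g h = -W.jacobiator f g h := by
  simp only [jacobiator, bracket_neg_left, bracket_neg_right]
  ring

theorem IsBivectorField.jacobiator_add_left (hW : W.IsBivectorField) {f f' g h : N → ℝ}
    (hf : ContMDiff I 𝓘(ℝ, ℝ) ∞ f) (hf' : ContMDiff I 𝓘(ℝ, ℝ) ∞ f')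
    (hg : ContMDiff I 𝓘(ℝ, ℝ) ∞ g) (hh : ContMDiff I 𝓘(ℝ, ℝ) ∞ h) :
    W.jacobiator (f + f') g h = W.jacobiator f g h + W.jacobiator f' g h := by
  simp only [jacobiator, bracket_add_left hf hf', bracket_add_right hf hf',
    bracket_add_left (hW.smooth _ _ hf hg) (hW.smooth _ _ hf' hg),
    bracket_add_left (hW.smooth _ _ hh hf) (hW.smooth _ _ hh hf')]
  ring

theorem IsBivectorField.jacobiator_swap (hW : W.IsBivectorField) (f g h : N → ℝ) :
    W.jacobiator f g h = -W.jacobiator g f h := by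
  rw [jacobiator, jacobiator, hW.bracket_swap f g, hW.bracket_swap g h, hW.bracket_swap h f]
  simp only [bracket_neg_left]
  ring

theorem IsBivectorField.jacobiator_eq (hW : W.IsBivectorField) (f g h : N → ℝ) :
    W.jacobiator f g h = W.bracket (W.bracket f g) h -
      (W.bracket f (W.bracket g h) - W.bracket g (W.bracket f h)) := by
  rw [jacobiator, hW.bracket_swap (W.bracket g h) f, hW.bracket_swap (W.bracket h f) g,
    hW.bracket_swap h f, bracket_neg_right]
  ring

/-- `X` is the Hamiltonian vector field of `f`: `b(X) = W(df, b)` for all covectors `b`. -/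
def IsHamiltonian (W : ContravariantTwoTensor I N) (f : N → ℝ) (X : ∀ x : N, TangentSpace I x) :
    Prop :=
  ∀ (x : N) (b : TangentSpace I x →L[ℝ] ℝ), b (X x) = W x (mvfderiv I f x) b

theorem IsHamiltonian.mvfderiv_apply {f : N → ℝ} {X : ∀ x : N, TangentSpace I x}
    (hX : W.IsHamiltonian f X) (g : N → ℝ) :
    (fun x => mvfderiv I g x (X x)) = W.bracket f g :=
  funext fun x => hX x _

variable [FiniteDimensional ℝ E]

theorem exists_isHamiltonian (W : ContravariantTwoTensor I N) (f : N → ℝ) :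
    ∃ X : ∀ x : N, TangentSpace I x, W.IsHamiltonian f X := by
  choose X hX using fun x => exists_forall_apply_eq_of_bidual (E := E) (W x (mvfderiv I f x))
  exact ⟨X, hX⟩

variable [IsManifold I ∞ N] [T2Space N]

theorem IsBivectorField.contMDiff_of_isHamiltonian (hW : W.IsBivectorField) {f : N → ℝ}
    (hf : ContMDiff I 𝓘(ℝ, ℝ) ∞ f) {X : ∀ x : N, TangentSpace I x} (hX : W.IsHamiltonian f X) :
    ContMDiff I I.tangent ∞ (T% X) := by
  intro x₀
  refine contMDiffAt_vectorField_of_coordinates fun l => ?_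
  obtain ⟨g, hg, hgl⟩ := exists_contMDiff_eventuallyEq_extChartAt (I := I) x₀ l
  exact ⟨g, hgl, hX.mvfderiv_apply g ▸ hW.smooth f g hf hg x₀⟩

variable [I.Boundaryless]

theorem IsBivectorField.jacobiator_apply_eq (hW : W.IsBivectorField) {f g h : N → ℝ}
    (hf : ContMDiff I 𝓘(ℝ, ℝ) ∞ f) (hg : ContMDiff I 𝓘(ℝ, ℝ) ∞ g)
    (hh : ContMDiff I 𝓘(ℝ, ℝ) ∞ h) {X Y : ∀ x : N, TangentSpace I x}
    (hX : W.IsHamiltonian f X) (hY : W.IsHamiltonian g Y) (x : N) :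
    W.jacobiator f g h x =
      W.bracket (W.bracket f g) h x - mvfderiv I h x (mlieBracket I X Y x) := by
  have : CompleteSpace E := FiniteDimensional.complete ℝ E
  rw [mvfderiv_mlieBracket hh
    ((hW.contMDiff_of_isHamiltonian hf hX x).mdifferentiableAt (by simp))
    ((hW.contMDiff_of_isHamiltonian hg hY x).mdifferentiableAt (by simp)),
    hX.mvfderiv_apply, hY.mvfderiv_apply, hX, hY, hW.jacobiator_eq]
  rfl

theorem IsBivectorField.jacobiator_eq_zero (hW : W.IsBivectorField) {f g h : N → ℝ}
    (hf : ContMDiff I 𝓘(ℝ, ℝ) ∞ f) (hg : ContMDiff I 𝓘(ℝ, ℝ) ∞ g)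
    (hh : ContMDiff I 𝓘(ℝ, ℝ) ∞ h) {x : N} (hx : mvfderiv I f x = 0) :
    W.jacobiator f g h x = 0 := by
  obtain ⟨X, hX⟩ := W.exists_isHamiltonian g
  obtain ⟨Y, hY⟩ := W.exists_isHamiltonian h
  rw [jacobiator_cyclic, hW.jacobiator_apply_eq hg hh hf hX hY, bracket, hx]
  simp

theorem IsBivectorField.jacobiator_congr_left (hW : W.IsBivectorField) {f f' g h : N → ℝ}
    (hf : ContMDiff I 𝓘(ℝ, ℝ) ∞ f) (hf' : ContMDiff I 𝓘(ℝ, ℝ) ∞ f')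
    (hg : ContMDiff I 𝓘(ℝ, ℝ) ∞ g) (hh : ContMDiff I 𝓘(ℝ, ℝ) ∞ h) {x : N}
    (hx : mvfderiv I f x = mvfderiv I f' x) :
    W.jacobiator f g h x = W.jacobiator f' g h x := by
  have hn : ContMDiff I 𝓘(ℝ, ℝ) ∞ (-f') := hf'.neg
  have hzero := hW.jacobiator_eq_zero (f := f + -f') (hf.add hn) hg hh (x := x) (by
    rw [mvfderiv_add ((hf x).mdifferentiableAt (by simp)) ((hn x).mdifferentiableAt (by simp)),
      mvfderiv_neg, hx, add_neg_cancel])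
  rwa [hW.jacobiator_add_left hf hn hg hh, jacobiator_neg_left, ← sub_eq_add_neg, Pi.sub_apply,
    sub_eq_zero] at hzero

theorem IsPoisson.isHamiltonian_mlieBracket (hW : W.IsPoisson) {f g : N → ℝ}
    (hf : ContMDiff I 𝓘(ℝ, ℝ) ∞ f) (hg : ContMDiff I 𝓘(ℝ, ℝ) ∞ g)
    {X Y : ∀ x : N, TangentSpace I x} (hX : W.IsHamiltonian f X) (hY : W.IsHamiltonian g Y) :
    W.IsHamiltonian (W.bracket f g) (mlieBracket I X Y) := by
  intro x b
  obtain ⟨h, hh, rfl⟩ := exists_mvfderiv_eq (I := I) x b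
  have hjacobi : W.jacobiator f g h x = 0 := congrFun (hW.jacobi f g h hf hg hh) x
  rw [hW.jacobiator_apply_eq hf hg hh hX hY, sub_eq_zero] at hjacobi
  exact hjacobi.symm

end ContravariantTwoTensor

end Jacobiator

section BaseManifold

open Filter Topology VectorField

variable {E : Type*} [NormedAddCommGroup E] [NormedSpace ℝ E]
  {M : Type*} [TopologicalSpace M] [ChartedSpace E M]

namespace ContravariantTwoTensor

variable [FiniteDimensional ℝ E] {w : ContravariantTwoTensor 𝓘(ℝ, E) M}

theorem isHamiltonian_hamiltonian (w : ContravariantTwoTensor 𝓘(ℝ, E) M)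
    (f : M → ℝ) : w.IsHamiltonian f (w.hamiltonian f) :=
  fun x b => w.apply_sharp x _ b

theorem IsBivectorField.apply_sharp_swap (hw : w.IsBivectorField) (x : M)
    (a b : CotangentSpace E x) : a (w.sharp x b) = -b (w.sharp x a) := by
  rw [w.apply_sharp, w.apply_sharp]
  exact hw.skew x b a

end ContravariantTwoTensor

variable [IsManifold 𝓘(ℝ, E) ∞ M]

theorem trivializationAt_coordVectorField (x₀ : M) (e : E) {x : M}
    (hx : x ∈ (chartAt E x₀).source) :
    (trivializationAt E (TangentSpace 𝓘(ℝ, E) : M → Type _) x₀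
      ⟨x, coordVectorField x₀ e x⟩).2 = e := by
  have hx' : x ∈ (trivializationAt E (TangentSpace 𝓘(ℝ, E) : M → Type _) x₀).baseSet := by
    simpa using hx
  have h := (trivializationAt E (TangentSpace 𝓘(ℝ, E) : M → Type _) x₀).continuousLinearMapAt_symmL
    (R := ℝ) hx' e
  rwa [Trivialization.continuousLinearMapAt_apply, Trivialization.linearMapAt_apply,
    if_pos hx'] at h

theorem contMDiffAt_coordVectorField (x₀ : M) (e : E) {x : M} (hx : x ∈ (chartAt E x₀).source) :
    ContMDiffAt 𝓘(ℝ, E) 𝓘(ℝ, E).tangent ∞ (T% (coordVectorField x₀ e)) x := by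
  rw [Trivialization.contMDiffAt_section_iff
    (e := trivializationAt E (TangentSpace 𝓘(ℝ, E) : M → Type _) x₀) (by simpa using hx)]
  refine (contMDiffAt_const (c := e)).congr_of_eventuallyEq ?_
  filter_upwards [(chartAt E x₀).open_source.mem_nhds hx] with y hy
  exact trivializationAt_coordVectorField x₀ e hy

theorem coordVectorField_mfderiv_extChartAt (x₀ : M) {x : M} (hx : x ∈ (chartAt E x₀).source)
    (v : TangentSpace 𝓘(ℝ, E) x) :
    coordVectorField (E := E) x₀ (mfderiv 𝓘(ℝ, E) 𝓘(ℝ, E) (extChartAt 𝓘(ℝ, E) x₀) x v : E) x =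
      v := by
  rw [← TangentBundle.continuousLinearMapAt_trivializationAt hx]
  exact (trivializationAt E (TangentSpace 𝓘(ℝ, E) : M → Type _) x₀).symmL_continuousLinearMapAt
    (R := ℝ) (by simpa using hx) v

theorem IsSmoothVectorField.mdifferentiableAt {Z : ∀ x : M, TangentSpace 𝓘(ℝ, E) x}
    (hZ : IsSmoothVectorField Z) (x : M) : MDiffAt (T% Z) x :=
  (hZ x).mdifferentiableAt (by simp)

theorem IsSmoothOneForm.contMDiff_apply {α : ∀ x : M, CotangentSpace E x}
    {Z : ∀ x : M, TangentSpace 𝓘(ℝ, E) x} (hα : IsSmoothOneForm α) (hZ : IsSmoothVectorField Z) :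
    ContMDiff 𝓘(ℝ, E) 𝓘(ℝ, ℝ) ∞ fun x => (α x (Z x) : ℝ) := fun x => by
  simpa using (contMDiffAt_totalSpace.1 ((hα x).clm_bundle_apply (hZ x))).2

namespace LinearConnection

variable {nabla : LinearConnection E M}

theorem contMDiff_covariantDerivative (hnabla : nabla.ContMDiffCovariantDerivative ∞)
    {Z : ∀ x : M, TangentSpace 𝓘(ℝ, E) x} (hZ : IsSmoothVectorField Z) :
    ContMDiff 𝓘(ℝ, E) (𝓘(ℝ, E).prod 𝓘(ℝ, E →L[ℝ] E)) ∞
      (fun x => (⟨x, nabla Z x⟩ : TotalSpace (E →L[ℝ] E)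
        fun x : M => TangentSpace 𝓘(ℝ, E) x →L[ℝ] TangentSpace 𝓘(ℝ, E) x)) :=
  contMDiffOn_univ.1 (hnabla.contMDiff.contMDiff (σ := Z) (ContMDiff.contMDiffOn hZ))

theorem isSmoothVectorField_deriv (hnabla : nabla.ContMDiffCovariantDerivative ∞)
    {X Z : ∀ x : M, TangentSpace 𝓘(ℝ, E) x} (hX : IsSmoothVectorField X)
    (hZ : IsSmoothVectorField Z) : IsSmoothVectorField (nabla.deriv X Z) :=
  (contMDiff_covariantDerivative hnabla hZ).clm_bundle_apply hX

theorem mdifferentiableAt_deriv (hnabla : nabla.ContMDiffCovariantDerivative ∞)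
    {X Z : ∀ x : M, TangentSpace 𝓘(ℝ, E) x} {x : M} (hX : MDiffAt (T% X) x)
    (hZ : IsSmoothVectorField Z) : MDiffAt (T% (nabla.deriv X Z)) x :=
  ((contMDiff_covariantDerivative hnabla hZ x).mdifferentiableAt (by simp)).clm_bundle_apply hX

end LinearConnection

variable [FiniteDimensional ℝ E]

theorem exists_contMDiff_eventuallyEq_coordVectorField [T2Space M] (x₀ : M) (e : E) :
    ∃ Z : ∀ x : M, TangentSpace 𝓘(ℝ, E) x, IsSmoothVectorField Z ∧
      ∀ᶠ x in 𝓝 x₀, Z x = coordVectorField x₀ e x := by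
  obtain ⟨χ⟩ : Nonempty (SmoothBumpFunction 𝓘(ℝ, E) x₀) := inferInstance
  refine ⟨fun x => χ x • coordVectorField x₀ e x, ?_, ?_⟩
  · refine ContMDiffOn.smul_section_of_tsupport (u := (chartAt E x₀).source)
      χ.contMDiff.contMDiffOn (chartAt E x₀).open_source χ.tsupport_subset_chartAt_source ?_
    exact fun x hx => (contMDiffAt_coordVectorField x₀ e hx).contMDiffWithinAt
  · filter_upwards [χ.eventuallyEq_one] with x hx
    simp [hx]

theorem exists_local_coframe [T2Space M] (x₀ : M) :
    ∃ (n : ℕ) (y : Fin n → M → ℝ) (Z : Fin n → ∀ x : M, TangentSpace 𝓘(ℝ, E) x),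
      (∀ i, ContMDiff 𝓘(ℝ, E) 𝓘(ℝ, ℝ) ∞ (y i)) ∧ (∀ i, IsSmoothVectorField (Z i)) ∧
      ∀ᶠ x in 𝓝 x₀, ∀ v : TangentSpace 𝓘(ℝ, E) x,
        v = ∑ i, mvfderiv 𝓘(ℝ, E) (y i) x v • Z i x := by
  let b := Module.finBasis ℝ E
  choose y hy hyl using fun i => exists_contMDiff_eventuallyEq_extChartAt (I := 𝓘(ℝ, E)) x₀
    (LinearMap.toContinuousLinearMap (b.coord i))
  choose Z hZ hZl using fun i => exists_contMDiff_eventuallyEq_coordVectorField x₀ (b i)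
  refine ⟨_, y, Z, hy, hZ, ?_⟩
  filter_upwards [eventually_all.2 hZl, eventually_all.2 fun i => (hyl i).eventuallyEq_nhds,
    (chartAt E x₀).open_source.mem_nhds (mem_chart_source E x₀)] with x hZx hyx hx v
  set u : E := mfderiv 𝓘(ℝ, E) 𝓘(ℝ, E) (extChartAt 𝓘(ℝ, E) x₀) x v
  have hdy : ∀ i, mvfderiv 𝓘(ℝ, E) (y i) x v = b.coord i u := fun i => by
    rw [mvfderiv_congr_of_eventuallyEq (hyx i), mvfderiv_clm_comp_extChartAt _ hx]
    rfl
  have hsum : coordVectorField x₀ (∑ i, b.coord i u • b i) x =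
      ∑ i, b.coord i u • coordVectorField x₀ (b i) x := by
    simp only [coordVectorField, map_sum, map_smul]
  simp only [hdy, hZx]
  rw [← hsum, show ∑ i, b.coord i u • b i = u from b.sum_repr u]
  exact (coordVectorField_mfderiv_extChartAt x₀ hx v).symm

theorem isSmoothOneForm_mvfderiv {f : M → ℝ} (hf : ContMDiff 𝓘(ℝ, E) 𝓘(ℝ, ℝ) ∞ f) :
    IsSmoothOneForm (fun x => (mvfderiv 𝓘(ℝ, E) f x : CotangentSpace E x)) := fun x₀ => by
  rw [contMDiffAt_hom_bundle]
  refine ⟨contMDiffAt_id, ?_⟩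
  let b := Module.finBasis ℝ E
  have hcoord : ContMDiffAt 𝓘(ℝ, E) 𝓘(ℝ, E →L[ℝ] ℝ) ∞ (fun x => ∑ i,
      mvfderiv 𝓘(ℝ, E) f x (coordVectorField x₀ (b i) x) •
        LinearMap.toContinuousLinearMap (b.coord i)) x₀ :=
    contMDiffAt_finsetSum fun i _ => (contMDiffAt_mvfderiv_apply hf
      (contMDiffAt_coordVectorField x₀ (b i) (mem_chart_source E x₀))).smul contMDiffAt_const
  refine hcoord.congr_of_eventuallyEq (Eventually.of_forall fun x => ?_)
  refine ContinuousLinearMap.coe_injective (b.ext fun j => ?_)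
  simp [ContinuousLinearMap.inCoordinates, coordVectorField, Finsupp.single_apply]

namespace ContravariantTwoTensor

variable [T2Space M] {w : ContravariantTwoTensor 𝓘(ℝ, E) M}

theorem IsBivectorField.isSmoothVectorField_hamiltonian (hw : w.IsBivectorField) {f : M → ℝ}
    (hf : ContMDiff 𝓘(ℝ, E) 𝓘(ℝ, ℝ) ∞ f) : IsSmoothVectorField (w.hamiltonian f) :=
  hw.contMDiff_of_isHamiltonian hf (w.isHamiltonian_hamiltonian f)

theorem IsBivectorField.isSmoothVectorField_sharp (hw : w.IsBivectorField)
    {α : ∀ x : M, CotangentSpace E x} (hα : IsSmoothOneForm α) :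
    IsSmoothVectorField fun x => w.sharp x (α x) := fun x₀ => by
  refine contMDiffAt_vectorField_of_coordinates fun l => ?_
  obtain ⟨g, hg, hgl⟩ := exists_contMDiff_eventuallyEq_extChartAt (I := 𝓘(ℝ, E)) x₀ l
  refine ⟨g, hgl, ContMDiffAt.congr_of_eventuallyEq
    (hα.contMDiff_apply (hw.isSmoothVectorField_hamiltonian hg) x₀).neg
    (Eventually.of_forall fun x => hw.apply_sharp_swap x _ _)⟩

theorem IsPoisson.mlieBracket_hamiltonian (hw : w.IsPoisson) {f g : M → ℝ}
    (hf : ContMDiff 𝓘(ℝ, E) 𝓘(ℝ, ℝ) ∞ f) (hg : ContMDiff 𝓘(ℝ, E) 𝓘(ℝ, ℝ) ∞ g) :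
    mlieBracket 𝓘(ℝ, E) (w.hamiltonian f) (w.hamiltonian g) = w.hamiltonian (w.bracket f g) := by
  ext1 x
  refine eq_of_forall_mvfderiv_eq fun h _ => ?_
  rw [hw.isHamiltonian_mlieBracket hf hg (w.isHamiltonian_hamiltonian f)
    (w.isHamiltonian_hamiltonian g), w.isHamiltonian_hamiltonian]

end ContravariantTwoTensor

end BaseManifold

section Curvature

open Filter Topology VectorField

variable {E : Type*} [NormedAddCommGroup E] [NormedSpace ℝ E]
  {M : Type*} [TopologicalSpace M] [ChartedSpace E M] [IsManifold 𝓘(ℝ, E) ∞ M]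
  {nabla : LinearConnection E M}

namespace LinearConnection

theorem curvature_swap (X Y Z : ∀ x : M, TangentSpace 𝓘(ℝ, E) x) :
    nabla.curvature X Y Z = -nabla.curvature Y X Z := by
  have h : nabla.deriv (mlieBracket 𝓘(ℝ, E) X Y) Z =
      -nabla.deriv (mlieBracket 𝓘(ℝ, E) Y X) Z := by
    funext x
    change nabla Z x (mlieBracket 𝓘(ℝ, E) X Y x) = -nabla Z x (mlieBracket 𝓘(ℝ, E) Y X x)
    rw [mlieBracket_swap_apply, map_neg]
  simp only [curvature, h]
  abel

variable [FiniteDimensional ℝ E]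

theorem curvature_tensorialAt_left (hnabla : nabla.ContMDiffCovariantDerivative ∞)
    {Z : ∀ x : M, TangentSpace 𝓘(ℝ, E) x} (hZ : IsSmoothVectorField Z)
    (Y : ∀ x : M, TangentSpace 𝓘(ℝ, E) x) (x : M) :
    TensorialAt 𝓘(ℝ, E) E (fun X => nabla.curvature X Y Z x) x := by
  have : CompleteSpace E := FiniteDimensional.complete ℝ E
  have hcurv : ∀ X, nabla.curvature X Y Z x = nabla (nabla.deriv Y Z) x (X x) -
      nabla (nabla.deriv X Z) x (Y x) - nabla Z x (mlieBracket 𝓘(ℝ, E) X Y x) := fun _ => rfl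
  constructor
  · intro f X hf hX
    have hderiv : nabla.deriv (f • X) Z = f • nabla.deriv X Z :=
      funext fun y => map_smul (nabla Z y) (f y) (X y)
    have hval : nabla Z x (X x) = nabla.deriv X Z x := rfl
    simp only [hcurv]
    rw [hderiv, nabla.isCovariantDerivativeOnUniv.leibniz (mdifferentiableAt_deriv hnabla hX hZ) hf,
      mlieBracket_smul_left hf hX]
    simp only [Pi.smul_apply', map_add, map_smul, map_neg, add_apply, smul_apply, hval,
      ContinuousLinearMap.smulRight_apply, neg_smul]
    module
  · intro X X' hX hX'
    have hderiv : nabla.deriv (X + X') Z = nabla.deriv X Z + nabla.deriv X' Z :=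
      funext fun y => map_add (nabla Z y) (X y) (X' y)
    simp only [hcurv]
    rw [hderiv, nabla.isCovariantDerivativeOnUniv.add (mdifferentiableAt_deriv hnabla hX hZ)
      (mdifferentiableAt_deriv hnabla hX' hZ), mlieBracket_add_left hX hX']
    simp only [Pi.add_apply, map_add, add_apply]
    module

theorem curvature_congr (hnabla : nabla.ContMDiffCovariantDerivative ∞)
    {X X' Y Y' Z : ∀ x : M, TangentSpace 𝓘(ℝ, E) x} (hX : IsSmoothVectorField X)
    (hX' : IsSmoothVectorField X') (hY : IsSmoothVectorField Y) (hY' : IsSmoothVectorField Y')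
    (hZ : IsSmoothVectorField Z) {x : M} (hXx : X x = X' x) (hYx : Y x = Y' x) :
    nabla.curvature X Y Z x = nabla.curvature X' Y' Z x := by
  have hleft : ∀ {X X' Y : ∀ x : M, TangentSpace 𝓘(ℝ, E) x}, IsSmoothVectorField X →
      IsSmoothVectorField X' → X x = X' x →
      nabla.curvature X Y Z x = nabla.curvature X' Y Z x := fun hX hX' h =>
    (curvature_tensorialAt_left hnabla hZ _ x).pointwise (hX.mdifferentiableAt x)
      (hX'.mdifferentiableAt x) h
  rw [hleft hX hX' hXx, curvature_swap, Pi.neg_apply, hleft hY hY' hYx, ← Pi.neg_apply,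
    ← curvature_swap]

end LinearConnection

variable [FiniteDimensional ℝ E] [T2Space M] {w : ContravariantTwoTensor 𝓘(ℝ, E) M}

namespace ContravariantTwoTensor

theorem IsPoisson.apply_mlieBracket_hamiltonian_sharp (hw : w.IsPoisson) {h : M → ℝ}
    (hh : ContMDiff 𝓘(ℝ, E) 𝓘(ℝ, ℝ) ∞ h) {α β : ∀ x : M, CotangentSpace E x}
    (hα : IsSmoothOneForm α) (hβ : IsSmoothOneForm β) (x : M) :
    β x (mlieBracket 𝓘(ℝ, E) (w.hamiltonian h) (fun y => w.sharp y (α y)) x) =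
      -lieDerivOneForm (w.hamiltonian h) α x (fun y => w.sharp y (β y)) := by
  have : CompleteSpace E := FiniteDimensional.complete ℝ E
  have hw' := hw.toIsBivectorField
  obtain ⟨k, hk, hkβ⟩ := exists_mvfderiv_eq (I := 𝓘(ℝ, E)) x (β x)
  have htensorial : lieDerivOneForm (w.hamiltonian h) α x (fun y => w.sharp y (β y)) =
      lieDerivOneForm (w.hamiltonian h) α x (w.hamiltonian k) :=
    (lieDerivOneForm_tensorialAt _ hα x).pointwise
      ((hw'.isSmoothVectorField_sharp hβ).mdifferentiableAt x)
      ((hw'.isSmoothVectorField_hamiltonian hk).mdifferentiableAt x)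
      (congrArg (w.sharp x) hkβ.symm)
  have hfirst : (fun y => mvfderiv 𝓘(ℝ, E) k y (w.sharp y (α y))) =
      -fun y => (α y (w.hamiltonian k y) : ℝ) :=
    funext fun y => hw'.apply_sharp_swap y _ _
  have hsecond : mvfderiv 𝓘(ℝ, E) (w.bracket h k) x (w.sharp x (α x)) =
      -(α x (mlieBracket 𝓘(ℝ, E) (w.hamiltonian h) (w.hamiltonian k) x) : ℝ) := by
    rw [hw.mlieBracket_hamiltonian hh hk]
    exact hw'.apply_sharp_swap x _ _
  have hlie := mvfderiv_mlieBracket hk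
    ((hw'.isSmoothVectorField_hamiltonian hh).mdifferentiableAt x)
    ((hw'.isSmoothVectorField_sharp hα).mdifferentiableAt x)
  rw [hfirst, (w.isHamiltonian_hamiltonian h).mvfderiv_apply, hsecond, mvfderiv_neg, hkβ] at hlie
  rw [htensorial, lieDerivOneForm]
  refine hlie.trans ?_
  simp only [neg_apply]
  ring

theorem IsPoisson.sharp_oneFormBracket (hw : w.IsPoisson) {α β : ∀ x : M, CotangentSpace E x}
    (hα : IsSmoothOneForm α) (hβ : IsSmoothOneForm β) :
    (fun x => w.sharp x (oneFormBracket w α β x)) =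
      mlieBracket 𝓘(ℝ, E) (fun x => w.sharp x (α x)) (fun x => w.sharp x (β x)) := by
  have : CompleteSpace E := FiniteDimensional.complete ℝ E
  have hw' := hw.toIsBivectorField
  funext x
  refine eq_of_forall_mvfderiv_eq (I := 𝓘(ℝ, E)) fun h hh => ?_
  have hXh := hw'.isSmoothVectorField_hamiltonian hh
  have hswap : ∀ γ : ∀ x : M, CotangentSpace E x,
      (fun y => mvfderiv 𝓘(ℝ, E) h y (w.sharp y (γ y))) = -fun y => (γ y (w.hamiltonian h y) : ℝ) :=
    fun γ => funext fun y => hw'.apply_sharp_swap y _ _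
  have hαβ : (fun y => (α y (w.sharp y (β y)) : ℝ)) = -fun y => w y (α y) (β y) :=
    funext fun y => (w.apply_sharp y _ _).trans (hw'.skew y _ _)
  have hβα := hw.apply_mlieBracket_hamiltonian_sharp hh hα hβ x
  rw [lieDerivOneForm, hαβ, mvfderiv_neg, mlieBracket_swap_apply, map_neg] at hβα
  rw [mvfderiv_mlieBracket hh ((hw'.isSmoothVectorField_sharp hα).mdifferentiableAt x)
    ((hw'.isSmoothVectorField_sharp hβ).mdifferentiableAt x), hswap, hswap, mvfderiv_neg,
    mvfderiv_neg]
  refine (hw'.apply_sharp_swap x _ _).trans ?_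
  refine (congrArg Neg.neg (oneFormBracket_apply w hα hβ hXh x)).trans ?_
  simp only [lieDerivOneForm, neg_apply] at hβα ⊢
  rw [mlieBracket_swap_apply (V := fun y => w.sharp y (β y)), map_neg]
  linarith

end ContravariantTwoTensor

theorem contravariantCurvature_eq_curvature_sharp (hw : w.IsPoisson)
    {α β : ∀ x : M, CotangentSpace E x} (hα : IsSmoothOneForm α) (hβ : IsSmoothOneForm β)
    (Z : ∀ x : M, TangentSpace 𝓘(ℝ, E) x) :
    contravariantCurvature w (nabla.contravariant w) α β Z =
      nabla.curvature (fun x => w.sharp x (α x)) (fun x => w.sharp x (β x)) Z := by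
  rw [LinearConnection.curvature, ← hw.sharp_oneFormBracket hα hβ]
  rfl

theorem contravariantCurvature_eq_zero_iff (hw : w.IsPoisson)
    (hnabla : nabla.ContMDiffCovariantDerivative ∞) :
    (∀ (α β : ∀ x : M, CotangentSpace E x) (Z : ∀ x : M, TangentSpace 𝓘(ℝ, E) x),
      IsSmoothOneForm α → IsSmoothOneForm β → IsSmoothVectorField Z →
      contravariantCurvature w (nabla.contravariant w) α β Z = 0) ↔
    ∀ (f g : M → ℝ) (Z : ∀ x : M, TangentSpace 𝓘(ℝ, E) x),
      ContMDiff 𝓘(ℝ, E) 𝓘(ℝ, ℝ) ∞ f → ContMDiff 𝓘(ℝ, E) 𝓘(ℝ, ℝ) ∞ g → IsSmoothVectorField Z →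
      nabla.curvature (w.hamiltonian f) (w.hamiltonian g) Z = 0 := by
  have hw' := hw.toIsBivectorField
  constructor
  · intro h f g Z hf hg hZ
    have hdf := isSmoothOneForm_mvfderiv hf
    have hdg := isSmoothOneForm_mvfderiv hg
    exact (contravariantCurvature_eq_curvature_sharp hw hdf hdg Z).symm.trans (h _ _ Z hdf hdg hZ)
  · intro h α β Z hα hβ hZ
    funext x
    obtain ⟨f, hf, hfα⟩ := exists_mvfderiv_eq (I := 𝓘(ℝ, E)) x (α x)
    obtain ⟨g, hg, hgβ⟩ := exists_mvfderiv_eq (I := 𝓘(ℝ, E)) x (β x)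
    rw [contravariantCurvature_eq_curvature_sharp hw hα hβ Z, ← h f g Z hf hg hZ]
    exact LinearConnection.curvature_congr hnabla (hw'.isSmoothVectorField_sharp hα)
      (hw'.isSmoothVectorField_hamiltonian hf) (hw'.isSmoothVectorField_sharp hβ)
      (hw'.isSmoothVectorField_hamiltonian hg) hZ (congrArg (w.sharp x) hfα.symm)
      (congrArg (w.sharp x) hgβ.symm)

end Curvature

section CotangentBundle

open Set Filter Topology

theorem totalSpace_t2Space {B F : Type*} [TopologicalSpace B] [T2Space B] [TopologicalSpace F]
    [T2Space F] (V : B → Type*) [TopologicalSpace (TotalSpace F V)] [∀ b, TopologicalSpace (V b)]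
    [FiberBundle F V] : T2Space (TotalSpace F V) := by
  refine ⟨fun u v huv => ?_⟩
  by_cases hproj : u.proj = v.proj
  · let e := trivializationAt F V u.proj
    have hu : u ∈ e.source := e.mem_source.2 (FiberBundle.mem_baseSet_trivializationAt' u.proj)
    have hv : v ∈ e.source := e.mem_source.2 (hproj ▸ e.mem_source.1 hu)
    obtain ⟨U, U', hU, hU', huU, hvU', hdisj⟩ := t2_separation fun h => huv (e.injOn hu hv h)
    exact ⟨e.source ∩ e ⁻¹' U, e.source ∩ e ⁻¹' U', e.isOpen_inter_preimage hU,
      e.isOpen_inter_preimage hU', ⟨hu, huU⟩, ⟨hv, hvU'⟩,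
      (hdisj.preimage e).mono inter_subset_right inter_subset_right⟩
  · exact separated_by_continuous (FiberBundle.continuous_proj F V) hproj

variable {E : Type*} [NormedAddCommGroup E] [NormedSpace ℝ E]
  {M : Type*} [TopologicalSpace M] [ChartedSpace E M]

theorem momentum_add (Z Z' : ∀ x : M, TangentSpace 𝓘(ℝ, E) x) :
    (momentum (Z + Z') : CotangentBundle E M → ℝ) = momentum Z + momentum Z' :=
  funext fun z => map_add z.2 (Z z.1) (Z' z.1)

theorem momentum_smul (f : M → ℝ) (Z : ∀ x : M, TangentSpace 𝓘(ℝ, E) x) :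
    momentum (f • Z) = (fun z : CotangentBundle E M => f z.1) * momentum Z :=
  funext fun z => map_smul z.2 (f z.1) (Z z.1)

variable [IsManifold 𝓘(ℝ, E) ∞ M]

instance cotangentBundle_t2Space [T2Space M] : T2Space (CotangentBundle E M) :=
  totalSpace_t2Space (CotangentSpace E : M → Type _)

theorem contMDiff_cotangentBundle_proj :
    ContMDiff (cotangentModel E) 𝓘(ℝ, E) ∞ (fun z : CotangentBundle E M => z.1) :=
  contMDiff_proj (CotangentSpace E : M → Type _)

theorem mdifferentiableAt_cotangentBundle_proj (u : CotangentBundle E M) :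
    MDifferentiableAt (cotangentModel E) 𝓘(ℝ, E) (fun z : CotangentBundle E M => z.1) u :=
  (contMDiff_cotangentBundle_proj u).mdifferentiableAt (by simp)

theorem extChartAt_cotangentBundle_fst (u z : CotangentBundle E M) :
    (extChartAt (cotangentModel E) u z).1 = extChartAt 𝓘(ℝ, E) u.1 z.1 :=
  rfl

theorem extChartAt_cotangentBundle_snd_apply (u z : CotangentBundle E M) (e : E) :
    (extChartAt (cotangentModel E) u z).2 e = momentum (coordVectorField u.1 e) z := by
  have hchart : extChartAt (cotangentModel E) u z = (extChartAt 𝓘(ℝ, E) u.1 z.1,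
      ContinuousLinearMap.inCoordinates E (TangentSpace 𝓘(ℝ, E) : M → Type _) ℝ
        (Bundle.Trivial M ℝ) u.1 z.1 u.1 z.1 z.2) :=
    hom_chart (𝕜 := ℝ) (F₁ := E) (E₁ := (TangentSpace 𝓘(ℝ, E) : M → Type _)) (F₂ := ℝ)
      (E₂ := Bundle.Trivial M ℝ) u z
  rw [hchart]
  simp [ContinuousLinearMap.inCoordinates, momentum, coordVectorField]

theorem mfderiv_cotangentBundle_proj (u : CotangentBundle E M) (ξ : E × (E →L[ℝ] ℝ)) :
    mfderiv (cotangentModel E) 𝓘(ℝ, E) (fun z : CotangentBundle E M => z.1) u ξ = (ξ.1 : E) := by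
  have hleft := mfderiv_comp_apply (I := cotangentModel E) (I' := 𝓘(ℝ, E)) (I'' := 𝓘(ℝ, E)) u
    (mdifferentiableAt_extChartAt (mem_chart_source E u.1))
    (mdifferentiableAt_cotangentBundle_proj u) ξ
  have hright := mfderiv_comp_apply (I := cotangentModel E) (I' := 𝓘(ℝ, E × (E →L[ℝ] ℝ)))
    (I'' := 𝓘(ℝ, E)) (g := Prod.fst) u
    (ContinuousLinearMap.fst ℝ E (E →L[ℝ] ℝ)).differentiableAt.mdifferentiableAt
    (mdifferentiableAt_extChartAt (mem_chart_source _ u)) ξ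
  have hcomp : extChartAt 𝓘(ℝ, E) u.1 ∘ (fun z : CotangentBundle E M => z.1) =
      Prod.fst ∘ extChartAt (cotangentModel E) u := rfl
  rw [hcomp, mfderiv_extChartAt_self] at hleft
  rw [mfderiv_extChartAt_self, mfderiv_eq_fderiv] at hright
  exact (hleft.symm.trans hright).trans
    (DFunLike.congr_fun (ContinuousLinearMap.fst ℝ E (E →L[ℝ] ℝ)).fderiv ξ)

theorem mvfderiv_comp_proj {f : M → ℝ} {u : CotangentBundle E M}
    (hf : MDifferentiableAt 𝓘(ℝ, E) 𝓘(ℝ, ℝ) f u.1) (ξ : TangentSpace (cotangentModel E) u) :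
    mvfderiv (cotangentModel E) (fun z : CotangentBundle E M => f z.1) u ξ =
      mvfderiv 𝓘(ℝ, E) f u.1 (ξ.1 : E) :=
  (mvfderiv_comp_apply u hf (mdifferentiableAt_cotangentBundle_proj u) ξ).trans
    (congrArg (mvfderiv 𝓘(ℝ, E) f u.1) (mfderiv_cotangentBundle_proj u ξ))

theorem contMDiff_comp_proj {f : M → ℝ} (hf : ContMDiff 𝓘(ℝ, E) 𝓘(ℝ, ℝ) ∞ f) :
    ContMDiff (cotangentModel E) 𝓘(ℝ, ℝ) ∞ (fun z : CotangentBundle E M => f z.1) :=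
  hf.comp contMDiff_cotangentBundle_proj

theorem mdifferentiableAt_momentum {Z : ∀ x : M, TangentSpace 𝓘(ℝ, E) x} {u : CotangentBundle E M}
    (hZ : MDiffAt (T% Z) u.1) :
    MDifferentiableAt (cotangentModel E) 𝓘(ℝ, ℝ) (momentum Z) u := by
  have hcovector : MDifferentiableAt (cotangentModel E) (𝓘(ℝ, E).prod 𝓘(ℝ, E →L[ℝ] ℝ))
      (fun z : CotangentBundle E M => TotalSpace.mk' (E →L[ℝ] ℝ)
        (E := fun x : M => TangentSpace 𝓘(ℝ, E) x →L[ℝ] Bundle.Trivial M ℝ x) z.1 z.2) u :=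
    mdifferentiableAt_id
  have hvector : MDifferentiableAt (cotangentModel E) 𝓘(ℝ, E).tangent
      (fun z : CotangentBundle E M => TotalSpace.mk' E z.1 (Z z.1)) u :=
    MDifferentiableAt.comp (g := T% Z) u hZ (mdifferentiableAt_cotangentBundle_proj u)
  unfold momentum
  simpa using ((mdifferentiableAt_totalSpace _ _).1 (hcovector.clm_bundle_apply hvector)).2

theorem contMDiff_momentum {Z : ∀ x : M, TangentSpace 𝓘(ℝ, E) x} (hZ : IsSmoothVectorField Z) :
    ContMDiff (cotangentModel E) 𝓘(ℝ, ℝ) ∞ (momentum Z) := fun u => by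
  have hcovector : ContMDiffAt (cotangentModel E) (𝓘(ℝ, E).prod 𝓘(ℝ, E →L[ℝ] ℝ)) ∞
      (fun z : CotangentBundle E M => TotalSpace.mk' (E →L[ℝ] ℝ)
        (E := fun x : M => TangentSpace 𝓘(ℝ, E) x →L[ℝ] Bundle.Trivial M ℝ x) z.1 z.2) u :=
    contMDiffAt_id
  have hvector : ContMDiffAt (cotangentModel E) 𝓘(ℝ, E).tangent ∞
      (fun z : CotangentBundle E M => TotalSpace.mk' E z.1 (Z z.1)) u :=
    ContMDiffAt.comp (g := T% Z) u (hZ u.1) (contMDiff_cotangentBundle_proj u)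
  unfold momentum
  simpa using (contMDiffAt_totalSpace.1 (hcovector.clm_bundle_apply hvector)).2

theorem coordVectorField_self (x : M) (e : E) : coordVectorField x e x = e := by
  have h := coordVectorField_mfderiv_extChartAt x (mem_chart_source E x) e
  rwa [mfderiv_extChartAt_self] at h

theorem mvfderiv_momentum_coordVectorField (u : CotangentBundle E M) (e : E)
    (ξ : TangentSpace (cotangentModel E) u) :
    mvfderiv (cotangentModel E) (momentum (coordVectorField u.1 e)) u ξ =
      (ξ : E × (E →L[ℝ] ℝ)).2 e := by
  let l : E × (E →L[ℝ] ℝ) →L[ℝ] ℝ :=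
    ContinuousLinearMap.apply ℝ ℝ e ∘L ContinuousLinearMap.snd ℝ E (E →L[ℝ] ℝ)
  have hl : (momentum (coordVectorField u.1 e) : CotangentBundle E M → ℝ) =
      fun z => l (extChartAt (cotangentModel E) u z) :=
    funext fun z => (extChartAt_cotangentBundle_snd_apply u z e).symm
  rw [hl, mvfderiv_clm_comp_extChartAt l (mem_chart_source _ u), mfderiv_extChartAt_self]
  rfl

variable [FiniteDimensional ℝ E] [T2Space M]

theorem exists_comp_proj_add_momentum_eventuallyEq (u : CotangentBundle E M)
    (l : E × (E →L[ℝ] ℝ) →L[ℝ] ℝ) :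
    ∃ (f : M → ℝ) (Z : ∀ x : M, TangentSpace 𝓘(ℝ, E) x),
      ContMDiff 𝓘(ℝ, E) 𝓘(ℝ, ℝ) ∞ f ∧ IsSmoothVectorField Z ∧
      (fun z => f z.1) + momentum Z =ᶠ[𝓝 u] fun z => l (extChartAt (cotangentModel E) u z) := by
  obtain ⟨e, he⟩ := exists_forall_apply_eq_of_bidual
    (l ∘L ContinuousLinearMap.inr ℝ E (E →L[ℝ] ℝ)).toLinearMap
  have hl : ∀ p : E × (E →L[ℝ] ℝ),
      l p = (l ∘L ContinuousLinearMap.inl ℝ E (E →L[ℝ] ℝ)) p.1 + p.2 e := fun p =>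
    calc l p = l ((p.1, 0) + (0, p.2)) := by simp
      _ = l (p.1, 0) + l (0, p.2) := map_add l _ _
      _ = _ := by rw [he]; rfl
  obtain ⟨f, hf, hfl⟩ := exists_contMDiff_eventuallyEq_extChartAt (I := 𝓘(ℝ, E)) u.1
    (l ∘L ContinuousLinearMap.inl ℝ E (E →L[ℝ] ℝ))
  obtain ⟨Z, hZ, hZe⟩ := exists_contMDiff_eventuallyEq_coordVectorField u.1 e
  refine ⟨f, Z, hf, hZ, ?_⟩
  have hproj : Tendsto (fun z : CotangentBundle E M => z.1) (𝓝 u) (𝓝 u.1) :=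
    contMDiff_cotangentBundle_proj.continuous.tendsto u
  filter_upwards [hproj.eventually hfl, hproj.eventually hZe] with z hfz hZz
  rw [hl, extChartAt_cotangentBundle_snd_apply, extChartAt_cotangentBundle_fst, Pi.add_apply, hfz]
  simp only [momentum, hZz]

theorem exists_mvfderiv_comp_proj_add_momentum_eq (u : CotangentBundle E M)
    (a : TangentSpace (cotangentModel E) u →L[ℝ] ℝ) :
    ∃ (f : M → ℝ) (Z : ∀ x : M, TangentSpace 𝓘(ℝ, E) x),
      ContMDiff 𝓘(ℝ, E) 𝓘(ℝ, ℝ) ∞ f ∧ IsSmoothVectorField Z ∧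
      mvfderiv (cotangentModel E) ((fun z => f z.1) + momentum Z) u = a := by
  let l : E × (E →L[ℝ] ℝ) →L[ℝ] ℝ := a
  obtain ⟨f, Z, hf, hZ, hfZ⟩ := exists_comp_proj_add_momentum_eventuallyEq u l
  refine ⟨f, Z, hf, hZ, ContinuousLinearMap.ext fun ξ => ?_⟩
  rw [mvfderiv_congr_of_eventuallyEq hfZ, mvfderiv_clm_comp_extChartAt l (mem_chart_source _ u),
    mfderiv_extChartAt_self]
  rfl

end CotangentBundle

section HorizontalLift

open Filter Topology

theorem mvfderiv_sum_mul_eq_zero {E : Type*} [NormedAddCommGroup E] [NormedSpace ℝ E]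
    {H : Type*} [TopologicalSpace H] {I : ModelWithCorners ℝ E H}
    {N : Type*} [TopologicalSpace N] [ChartedSpace H N] {ι : Type} (s : Finset ι)
    {f g : ι → N → ℝ} {x : N} (hf : ∀ i, MDifferentiableAt I 𝓘(ℝ, ℝ) (f i) x)
    (hg : ∀ i, MDifferentiableAt I 𝓘(ℝ, ℝ) (g i) x) (hfx : ∀ i, f i x = 0)
    (hgx : ∀ i, g i x = 0) :
    mvfderiv I (∑ i ∈ s, f i * g i) x = 0 := by
  classical
  induction s using Finset.induction_on with
  | empty => exact mvfderiv_zero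
  | insert i s hi ih =>
    have hsum : MDifferentiableAt I 𝓘(ℝ, ℝ) (∑ j ∈ s, f j * g j) x :=
      MDifferentiableAt.sum fun j _ => (hf j).mul (hg j)
    rw [Finset.sum_insert hi, mvfderiv_add ((hf i).mul (hg i)) hsum, ih,
      mvfderiv_mul (hf i) (hg i), hfx, hgx, zero_smul, zero_smul, add_zero, add_zero]

variable {E : Type*} [NormedAddCommGroup E] [NormedSpace ℝ E] [FiniteDimensional ℝ E]
  {M : Type*} [TopologicalSpace M] [ChartedSpace E M] [IsManifold 𝓘(ℝ, E) ∞ M]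
  {nabla : LinearConnection E M} {w : ContravariantTwoTensor 𝓘(ℝ, E) M}

theorem mvfderiv_comp_proj_horizontalLift {f : M → ℝ} {u : CotangentBundle E M}
    (hf : MDifferentiableAt 𝓘(ℝ, E) 𝓘(ℝ, ℝ) f u.1) (v : TangentSpace 𝓘(ℝ, E) u.1) :
    mvfderiv (cotangentModel E) (fun z : CotangentBundle E M => f z.1) u
      (horizontalLift nabla u v) = mvfderiv 𝓘(ℝ, E) f u.1 v :=
  mvfderiv_comp_proj hf _

theorem mvfderiv_momentum_horizontalLift {Z : ∀ x : M, TangentSpace 𝓘(ℝ, E) x}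
    {u : CotangentBundle E M} (hZ : MDiffAt (T% Z) u.1) (v : TangentSpace 𝓘(ℝ, E) u.1) :
    mvfderiv (cotangentModel E) (momentum Z) u (horizontalLift nabla u v) =
      u.2 (nabla Z u.1 v) := by
  let defect : (∀ x : M, TangentSpace 𝓘(ℝ, E) x) → ℝ := fun Z =>
    mvfderiv (cotangentModel E) (momentum Z) u (horizontalLift nabla u v) - u.2 (nabla Z u.1 v)
  have htensorial : TensorialAt 𝓘(ℝ, E) E defect u.1 := by
    constructor
    · intro f Z hf hZ
      have hfπ : MDifferentiableAt (cotangentModel E) 𝓘(ℝ, ℝ)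
          (fun z : CotangentBundle E M => f z.1) u :=
        MDifferentiableAt.comp (g := f) u hf (mdifferentiableAt_cotangentBundle_proj u)
      simp only [defect]
      rw [momentum_smul, mvfderiv_mul hfπ (mdifferentiableAt_momentum hZ),
        nabla.isCovariantDerivativeOnUniv.leibniz hZ hf]
      simp only [add_apply, smul_apply, ContinuousLinearMap.smulRight_apply, map_add, map_smul,
        smul_eq_mul, mvfderiv_comp_proj_horizontalLift hf, momentum]
      ring
    · intro Z Z' hZ hZ'
      simp only [defect]
      rw [momentum_add, mvfderiv_add (mdifferentiableAt_momentum hZ)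
        (mdifferentiableAt_momentum hZ'), nabla.isCovariantDerivativeOnUniv.add hZ hZ']
      simp only [add_apply, map_add]
      ring
  -- For coordinate fields the identity is the definition of the vertical part of the lift.
  have hcoord : defect (coordVectorField u.1 (Z u.1 : E)) = 0 :=
    sub_eq_zero.2 (mvfderiv_momentum_coordVectorField u (Z u.1 : E) _)
  exact sub_eq_zero.1 ((htensorial.pointwise hZ
    (coordVectorField_mdifferentiableAt (E := E) u.1 (Z u.1 : E))
    (coordVectorField_self (E := E) u.1 (Z u.1 : E)).symm).trans hcoord)

/-- The restriction of the differential of a function on `T*M` to the horizontal space at `u`,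
as a covector of `M` at the base point of `u`. -/
noncomputable def horizontalDifferential (nabla : LinearConnection E M)
    (F : CotangentBundle E M → ℝ) (u : CotangentBundle E M) : TangentSpace 𝓘(ℝ, E) u.1 →L[ℝ] ℝ :=
  (mvfderiv (cotangentModel E) F u).comp (horizontalLift nabla u)

theorem horizontalDifferential_comp_proj {f : M → ℝ} {u : CotangentBundle E M}
    (hf : MDifferentiableAt 𝓘(ℝ, E) 𝓘(ℝ, ℝ) f u.1) :
    horizontalDifferential nabla (fun z => f z.1) u = mvfderiv 𝓘(ℝ, E) f u.1 :=
  ContinuousLinearMap.ext fun v => mvfderiv_comp_proj_horizontalLift hf v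

theorem horizontalLiftTensor_bracket (F G : CotangentBundle E M → ℝ) (u : CotangentBundle E M) :
    (horizontalLiftTensor nabla w).bracket F G u =
      w u.1 (horizontalDifferential nabla F u) (horizontalDifferential nabla G u) :=
  rfl

theorem horizontalLiftTensor_bracket_comp_proj {f g : M → ℝ}
    (hf : ContMDiff 𝓘(ℝ, E) 𝓘(ℝ, ℝ) ∞ f) (hg : ContMDiff 𝓘(ℝ, E) 𝓘(ℝ, ℝ) ∞ g) :
    (horizontalLiftTensor nabla w).bracket (fun z => f z.1) (fun z => g z.1) =
      fun z => w.bracket f g z.1 := by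
  funext u
  rw [horizontalLiftTensor_bracket,
    horizontalDifferential_comp_proj ((hf _).mdifferentiableAt (by simp)),
    horizontalDifferential_comp_proj ((hg _).mdifferentiableAt (by simp))]
  rfl

theorem horizontalLiftTensor_bracket_comp_proj_momentum {f : M → ℝ}
    (hf : ContMDiff 𝓘(ℝ, E) 𝓘(ℝ, ℝ) ∞ f) {Z : ∀ x : M, TangentSpace 𝓘(ℝ, E) x}
    (hZ : IsSmoothVectorField Z) :
    (horizontalLiftTensor nabla w).bracket (fun z => f z.1) (momentum Z) =
      momentum (nabla.deriv (w.hamiltonian f) Z) := by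
  funext u
  rw [horizontalLiftTensor_bracket,
    horizontalDifferential_comp_proj ((hf _).mdifferentiableAt (by simp))]
  exact (w.isHamiltonian_hamiltonian f u.1 _).symm.trans
    (mvfderiv_momentum_horizontalLift (hZ.mdifferentiableAt _) _)

variable [T2Space M]

theorem contMDiff_horizontalLift (hnabla : nabla.ContMDiffCovariantDerivative ∞)
    {V : ∀ x : M, TangentSpace 𝓘(ℝ, E) x} (hV : IsSmoothVectorField V) :
    ContMDiff (cotangentModel E) (cotangentModel E).tangent ∞
      (T% (fun u : CotangentBundle E M => horizontalLift nabla u (V u.1))) := fun u => by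
  refine contMDiffAt_vectorField_of_coordinates fun l => ?_
  obtain ⟨f, Z, hf, hZ, hfZ⟩ := exists_comp_proj_add_momentum_eventuallyEq u l
  refine ⟨_, hfZ, ?_⟩
  have hderiv : (fun z => mvfderiv (cotangentModel E) ((fun z => f z.1) + momentum Z) z
      (horizontalLift nabla z (V z.1))) =
      (fun z => mvfderiv 𝓘(ℝ, E) f z.1 (V z.1)) + momentum (nabla.deriv V Z) := by
    funext z
    rw [mvfderiv_add ((contMDiff_comp_proj hf z).mdifferentiableAt (by simp))
      ((contMDiff_momentum hZ z).mdifferentiableAt (by simp)), add_apply,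
      mvfderiv_momentum_horizontalLift (hZ.mdifferentiableAt _),
      mvfderiv_comp_proj_horizontalLift ((hf _).mdifferentiableAt (by simp))]
    rfl
  have hbase : ContMDiff 𝓘(ℝ, E) 𝓘(ℝ, ℝ) ∞ fun x => mvfderiv 𝓘(ℝ, E) f x (V x) :=
    fun x => contMDiffAt_mvfderiv_apply hf (hV x)
  rw [hderiv]
  exact (contMDiff_comp_proj hbase).add
    (contMDiff_momentum (LinearConnection.isSmoothVectorField_deriv hnabla hV hZ)) u

theorem exists_local_horizontalLiftTensor_bracket (u : CotangentBundle E M) :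
    ∃ (n : ℕ) (y : Fin n → M → ℝ) (Z : Fin n → ∀ x : M, TangentSpace 𝓘(ℝ, E) x),
      (∀ i, ContMDiff 𝓘(ℝ, E) 𝓘(ℝ, ℝ) ∞ (y i)) ∧ (∀ i, IsSmoothVectorField (Z i)) ∧
      ∀ F G : CotangentBundle E M → ℝ, (horizontalLiftTensor nabla w).bracket F G =ᶠ[𝓝 u]
        fun z => ∑ i, horizontalDifferential nabla F z (Z i z.1) *
          horizontalDifferential nabla G z (w.hamiltonian (y i) z.1) := by
  obtain ⟨n, y, Z, hy, hZ, hcoframe⟩ := exists_local_coframe (E := E) u.1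
  refine ⟨n, y, Z, hy, hZ, fun F G => ?_⟩
  have hproj : Tendsto (fun z : CotangentBundle E M => z.1) (𝓝 u) (𝓝 u.1) :=
    contMDiff_cotangentBundle_proj.continuous.tendsto u
  filter_upwards [hproj.eventually hcoframe] with z hz
  have hexpand : horizontalDifferential nabla F z = ∑ i,
      horizontalDifferential nabla F z (Z i z.1) • mvfderiv 𝓘(ℝ, E) (y i) z.1 := by
    refine ContinuousLinearMap.ext fun v => ?_
    conv_lhs => rw [hz v]
    simp [map_sum, mul_comm]
  rw [horizontalLiftTensor_bracket, hexpand, map_sum, LinearMap.sum_apply, ← hexpand]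
  refine Finset.sum_congr rfl fun i _ => ?_
  rw [map_smul, LinearMap.smul_apply, smul_eq_mul]
  exact congrArg _ (w.isHamiltonian_hamiltonian (y i) z.1 (horizontalDifferential nabla G z)).symm

theorem contMDiff_horizontalDifferential_apply (hnabla : nabla.ContMDiffCovariantDerivative ∞)
    {F : CotangentBundle E M → ℝ} (hF : ContMDiff (cotangentModel E) 𝓘(ℝ, ℝ) ∞ F)
    {V : ∀ x : M, TangentSpace 𝓘(ℝ, E) x} (hV : IsSmoothVectorField V) :
    ContMDiff (cotangentModel E) 𝓘(ℝ, ℝ) ∞ fun z => horizontalDifferential nabla F z (V z.1) :=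
  fun u => contMDiffAt_mvfderiv_apply hF (contMDiff_horizontalLift hnabla hV u)

theorem isBivectorField_horizontalLiftTensor (hw : w.IsBivectorField)
    (hnabla : nabla.ContMDiffCovariantDerivative ∞) :
    (horizontalLiftTensor nabla w).IsBivectorField := by
  refine ⟨fun u a => hw.alternating u.1 _, fun F G hF hG u => ?_⟩
  obtain ⟨n, y, Z, hy, hZ, hbracket⟩ :=
    exists_local_horizontalLiftTensor_bracket (nabla := nabla) (w := w) u
  refine ContMDiffAt.congr_of_eventuallyEq ?_ (hbracket F G)
  exact contMDiffAt_finsetSum fun i _ =>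
    (contMDiff_horizontalDifferential_apply hnabla hF (hZ i) u).mul
      (contMDiff_horizontalDifferential_apply hnabla hG
        (hw.isSmoothVectorField_hamiltonian (hy i)) u)

theorem mvfderiv_horizontalLiftTensor_bracket_eq_zero (hw : w.IsBivectorField)
    (hnabla : nabla.ContMDiffCovariantDerivative ∞) {F G : CotangentBundle E M → ℝ}
    (hF : ContMDiff (cotangentModel E) 𝓘(ℝ, ℝ) ∞ F) (hG : ContMDiff (cotangentModel E) 𝓘(ℝ, ℝ) ∞ G)
    {u : CotangentBundle E M} (hFu : horizontalDifferential nabla F u = 0)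
    (hGu : horizontalDifferential nabla G u = 0) :
    mvfderiv (cotangentModel E) ((horizontalLiftTensor nabla w).bracket F G) u = 0 := by
  obtain ⟨n, y, Z, hy, hZ, hbracket⟩ :=
    exists_local_horizontalLiftTensor_bracket (nabla := nabla) (w := w) u
  have hsum : (horizontalLiftTensor nabla w).bracket F G =ᶠ[𝓝 u]
      ∑ i, (fun z => horizontalDifferential nabla F z (Z i z.1)) *
        fun z => horizontalDifferential nabla G z (w.hamiltonian (y i) z.1) :=
    (hbracket F G).trans (.of_eq (by ext z; simp))
  rw [mvfderiv_congr_of_eventuallyEq hsum]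
  exact mvfderiv_sum_mul_eq_zero Finset.univ
    (fun i => (contMDiff_horizontalDifferential_apply hnabla hF (hZ i) u).mdifferentiableAt
      (by simp))
    (fun i => (contMDiff_horizontalDifferential_apply hnabla hG
      (hw.isSmoothVectorField_hamiltonian (hy i)) u).mdifferentiableAt (by simp))
    (fun i => DFunLike.congr_fun hFu _) (fun i => DFunLike.congr_fun hGu _)

end HorizontalLift

section JacobiatorOfHorizontalLift

variable {E : Type*} [NormedAddCommGroup E] [NormedSpace ℝ E] [FiniteDimensional ℝ E]
  {M : Type*} [TopologicalSpace M] [ChartedSpace E M] [IsManifold 𝓘(ℝ, E) ∞ M]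
  {nabla : LinearConnection E M} {w : ContravariantTwoTensor 𝓘(ℝ, E) M}

theorem jacobiator_comp_proj (hw : w.IsPoisson) {f g h : M → ℝ}
    (hf : ContMDiff 𝓘(ℝ, E) 𝓘(ℝ, ℝ) ∞ f) (hg : ContMDiff 𝓘(ℝ, E) 𝓘(ℝ, ℝ) ∞ g)
    (hh : ContMDiff 𝓘(ℝ, E) 𝓘(ℝ, ℝ) ∞ h) :
    (horizontalLiftTensor nabla w).jacobiator (fun z => f z.1) (fun z => g z.1)
      (fun z => h z.1) = 0 := by
  rw [ContravariantTwoTensor.jacobiator, horizontalLiftTensor_bracket_comp_proj hf hg,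
    horizontalLiftTensor_bracket_comp_proj hg hh, horizontalLiftTensor_bracket_comp_proj hh hf,
    horizontalLiftTensor_bracket_comp_proj (hw.smooth f g hf hg) hh,
    horizontalLiftTensor_bracket_comp_proj (hw.smooth g h hg hh) hf,
    horizontalLiftTensor_bracket_comp_proj (hw.smooth h f hh hf) hg]
  exact funext fun z => congrFun (hw.jacobi f g h hf hg hh) z.1

variable [T2Space M]

theorem jacobiator_comp_proj_momentum (hw : w.IsPoisson)
    (hnabla : nabla.ContMDiffCovariantDerivative ∞) {f g : M → ℝ}
    (hf : ContMDiff 𝓘(ℝ, E) 𝓘(ℝ, ℝ) ∞ f) (hg : ContMDiff 𝓘(ℝ, E) 𝓘(ℝ, ℝ) ∞ g)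
    {Z : ∀ x : M, TangentSpace 𝓘(ℝ, E) x} (hZ : IsSmoothVectorField Z) :
    (horizontalLiftTensor nabla w).jacobiator (fun z => f z.1) (fun z => g z.1) (momentum Z) =
      -momentum (nabla.curvature (w.hamiltonian f) (w.hamiltonian g) Z) := by
  have hw' := hw.toIsBivectorField
  have hZf := LinearConnection.isSmoothVectorField_deriv hnabla
    (hw'.isSmoothVectorField_hamiltonian hf) hZ
  have hZg := LinearConnection.isSmoothVectorField_deriv hnabla
    (hw'.isSmoothVectorField_hamiltonian hg) hZ
  rw [(isBivectorField_horizontalLiftTensor hw' hnabla).jacobiator_eq,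
    horizontalLiftTensor_bracket_comp_proj hf hg,
    horizontalLiftTensor_bracket_comp_proj_momentum (hw.smooth f g hf hg) hZ,
    horizontalLiftTensor_bracket_comp_proj_momentum hg hZ,
    horizontalLiftTensor_bracket_comp_proj_momentum hf hZg,
    horizontalLiftTensor_bracket_comp_proj_momentum hf hZ,
    horizontalLiftTensor_bracket_comp_proj_momentum hg hZf,
    LinearConnection.curvature, hw.mlieBracket_hamiltonian hf hg]
  funext u
  simp only [Pi.neg_apply, Pi.sub_apply, momentum, map_sub]
  ring

theorem jacobiator_eq_zero_of_horizontalDifferential_eq_zero (hw : w.IsBivectorField)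
    (hnabla : nabla.ContMDiffCovariantDerivative ∞) {F G : CotangentBundle E M → ℝ}
    (hF : ContMDiff (cotangentModel E) 𝓘(ℝ, ℝ) ∞ F) (hG : ContMDiff (cotangentModel E) 𝓘(ℝ, ℝ) ∞ G)
    {u : CotangentBundle E M} (hFu : horizontalDifferential nabla F u = 0)
    (hGu : horizontalDifferential nabla G u = 0) (K : CotangentBundle E M → ℝ) :
    (horizontalLiftTensor nabla w).jacobiator F G K u = 0 := by
  have hd : horizontalDifferential nabla ((horizontalLiftTensor nabla w).bracket F G) u = 0 := by
    rw [horizontalDifferential,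
      mvfderiv_horizontalLiftTensor_bracket_eq_zero hw hnabla hF hG hFu hGu,
      ContinuousLinearMap.zero_comp]
  simp only [ContravariantTwoTensor.jacobiator, Pi.add_apply, horizontalLiftTensor_bracket, hd,
    hFu, hGu, map_zero, LinearMap.zero_apply, add_zero]

theorem exists_eq_comp_proj_add_of_horizontalDifferential_eq_zero {F : CotangentBundle E M → ℝ}
    (hF : ContMDiff (cotangentModel E) 𝓘(ℝ, ℝ) ∞ F) (u : CotangentBundle E M) :
    ∃ (f : M → ℝ) (G : CotangentBundle E M → ℝ), ContMDiff 𝓘(ℝ, E) 𝓘(ℝ, ℝ) ∞ f ∧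
      ContMDiff (cotangentModel E) 𝓘(ℝ, ℝ) ∞ G ∧ horizontalDifferential nabla G u = 0 ∧
      F = (fun z => f z.1) + G := by
  obtain ⟨f, hf, hfu⟩ := exists_mvfderiv_eq (I := 𝓘(ℝ, E)) u.1 (horizontalDifferential nabla F u)
  have hfπ := contMDiff_comp_proj hf
  refine ⟨f, F - fun z => f z.1, hf, hF.sub hfπ, ?_, by ring⟩
  rw [horizontalDifferential, mvfderiv_sub ((hF u).mdifferentiableAt (by simp))
    ((hfπ u).mdifferentiableAt (by simp)), ContinuousLinearMap.sub_comp]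
  exact sub_eq_zero.2
    (hfu.symm.trans (horizontalDifferential_comp_proj ((hf _).mdifferentiableAt (by simp))).symm)

theorem jacobiator_comp_proj_comp_proj_eq_zero (hw : w.IsPoisson)
    (hnabla : nabla.ContMDiffCovariantDerivative ∞)
    {f g : M → ℝ} (hf : ContMDiff 𝓘(ℝ, E) 𝓘(ℝ, ℝ) ∞ f) (hg : ContMDiff 𝓘(ℝ, E) 𝓘(ℝ, ℝ) ∞ g)
    (hR : ∀ Z, IsSmoothVectorField Z →
      nabla.curvature (w.hamiltonian f) (w.hamiltonian g) Z = 0)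
    {F : CotangentBundle E M → ℝ} (hF : ContMDiff (cotangentModel E) 𝓘(ℝ, ℝ) ∞ F) :
    (horizontalLiftTensor nabla w).jacobiator F (fun z => f z.1) (fun z => g z.1) = 0 := by
  funext u
  have hW := isBivectorField_horizontalLiftTensor hw.toIsBivectorField hnabla
  have hfπ := contMDiff_comp_proj hf
  have hgπ := contMDiff_comp_proj hg
  obtain ⟨h, Z, hh, hZ, hFu⟩ := exists_mvfderiv_comp_proj_add_momentum_eq u
    (mvfderiv (cotangentModel E) F u)
  have hhπ := contMDiff_comp_proj hh
  have hmZ := contMDiff_momentum hZ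
  rw [hW.jacobiator_congr_left hF (hhπ.add hmZ) hfπ hgπ hFu.symm,
    hW.jacobiator_add_left hhπ hmZ hfπ hgπ, jacobiator_comp_proj hw hh hf hg,
    ContravariantTwoTensor.jacobiator_cyclic, jacobiator_comp_proj_momentum hw hnabla hf hg hZ,
    hR Z hZ]
  simp [momentum]

theorem jacobiator_eq_zero_of_forall_jacobiator_comp_proj_eq_zero (hw : w.IsBivectorField)
    (hnabla : nabla.ContMDiffCovariantDerivative ∞) {K : CotangentBundle E M → ℝ}
    (hK : ContMDiff (cotangentModel E) 𝓘(ℝ, ℝ) ∞ K)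
    (hbase : ∀ (f : M → ℝ) (F : CotangentBundle E M → ℝ), ContMDiff 𝓘(ℝ, E) 𝓘(ℝ, ℝ) ∞ f →
      ContMDiff (cotangentModel E) 𝓘(ℝ, ℝ) ∞ F →
        (horizontalLiftTensor nabla w).jacobiator (fun z => f z.1) F K = 0)
    {F G : CotangentBundle E M → ℝ} (hF : ContMDiff (cotangentModel E) 𝓘(ℝ, ℝ) ∞ F)
    (hG : ContMDiff (cotangentModel E) 𝓘(ℝ, ℝ) ∞ G) :
    (horizontalLiftTensor nabla w).jacobiator F G K = 0 := by
  funext u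
  have hW := isBivectorField_horizontalLiftTensor hw hnabla
  obtain ⟨f, F', hf, hF', hF'u, rfl⟩ :=
    exists_eq_comp_proj_add_of_horizontalDifferential_eq_zero (nabla := nabla) hF u
  obtain ⟨g, G', hg, hG', hG'u, rfl⟩ :=
    exists_eq_comp_proj_add_of_horizontalDifferential_eq_zero (nabla := nabla) hG u
  rw [hW.jacobiator_add_left (contMDiff_comp_proj hf) hF' hG hK, hbase f _ hf hG, zero_add,
    hW.jacobiator_swap, hW.jacobiator_add_left (contMDiff_comp_proj hg) hG' hF' hK,
    hbase g _ hg hF', zero_add, Pi.neg_apply,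
    jacobiator_eq_zero_of_horizontalDifferential_eq_zero hw hnabla hG' hF' hG'u hF'u]
  exact neg_zero

theorem isPoisson_horizontalLiftTensor_iff (hw : w.IsPoisson)
    (hnabla : nabla.ContMDiffCovariantDerivative ∞) :
    (horizontalLiftTensor nabla w).IsPoisson ↔
      ∀ (f g : M → ℝ) (Z : ∀ x : M, TangentSpace 𝓘(ℝ, E) x),
        ContMDiff 𝓘(ℝ, E) 𝓘(ℝ, ℝ) ∞ f → ContMDiff 𝓘(ℝ, E) 𝓘(ℝ, ℝ) ∞ g →
          IsSmoothVectorField Z → nabla.curvature (w.hamiltonian f) (w.hamiltonian g) Z = 0 := by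
  have hw' := hw.toIsBivectorField
  have hW := isBivectorField_horizontalLiftTensor hw' hnabla
  constructor
  · intro hP f g Z hf hg hZ
    have hjacobi := hP.jacobi _ _ _ (contMDiff_comp_proj hf) (contMDiff_comp_proj hg)
      (contMDiff_momentum hZ)
    have hmomentum : momentum (nabla.curvature (w.hamiltonian f) (w.hamiltonian g) Z) = 0 :=
      neg_eq_zero.1 ((jacobiator_comp_proj_momentum hw hnabla hf hg hZ).symm.trans hjacobi)
    exact funext fun x => SeparatingDual.eq_zero_of_forall_dual_eq_zero (R := ℝ) (V := E)
      fun a => congrFun hmomentum (⟨x, a⟩ : CotangentBundle E M)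
  · intro hR
    have hbase {f : M → ℝ} (hf : ContMDiff 𝓘(ℝ, E) 𝓘(ℝ, ℝ) ∞ f) {F G : CotangentBundle E M → ℝ}
        (hF : ContMDiff (cotangentModel E) 𝓘(ℝ, ℝ) ∞ F)
        (hG : ContMDiff (cotangentModel E) 𝓘(ℝ, ℝ) ∞ G) :
        (horizontalLiftTensor nabla w).jacobiator F G (fun z => f z.1) = 0 :=
      jacobiator_eq_zero_of_forall_jacobiator_comp_proj_eq_zero hw' hnabla (contMDiff_comp_proj hf)
        (fun g K hg hK => (ContravariantTwoTensor.jacobiator_cyclic _ _ _).trans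
          (jacobiator_comp_proj_comp_proj_eq_zero hw hnabla hf hg (fun Z => hR f g Z hf hg) hK))
        hF hG
    exact ⟨hW, fun F G K hF hG hK =>
      jacobiator_eq_zero_of_forall_jacobiator_comp_proj_eq_zero hw' hnabla hK
        (fun f K' hf hK' => (ContravariantTwoTensor.jacobiator_cyclic _ _ _).trans
          (hbase hf hK' hK)) hF hG⟩

end JacobiatorOfHorizontalLift

theorem corollary3p5 {E : Type*} [NormedAddCommGroup E] [NormedSpace ℝ E] [FiniteDimensional ℝ E]
    {M : Type*} [TopologicalSpace M] [T2Space M] [ChartedSpace E M] [IsManifold 𝓘(ℝ, E) ∞ M]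
    (w : ContravariantTwoTensor 𝓘(ℝ, E) M) (hw : w.IsPoisson)
    (nabla : LinearConnection E M) (hnabla : nabla.ContMDiffCovariantDerivative ∞) :
    ((horizontalLiftTensor nabla w).IsPoisson ↔
      ∀ (α β : ∀ x : M, CotangentSpace E x) (Z : ∀ x : M, TangentSpace 𝓘(ℝ, E) x),
        IsSmoothOneForm α → IsSmoothOneForm β → IsSmoothVectorField Z →
          contravariantCurvature w (nabla.contravariant w) α β Z = 0) ∧
    ((horizontalLiftTensor nabla w).IsPoisson ↔
      ∀ (f g : M → ℝ) (Z : ∀ x : M, TangentSpace 𝓘(ℝ, E) x),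
        ContMDiff 𝓘(ℝ, E) 𝓘(ℝ, ℝ) ∞ f → ContMDiff 𝓘(ℝ, E) 𝓘(ℝ, ℝ) ∞ g →
          IsSmoothVectorField Z →
            nabla.curvature (w.hamiltonian f) (w.hamiltonian g) Z = 0) := by
  have h := isPoisson_horizontalLiftTensor_iff hw hnabla
  exact ⟨h.trans (contravariantCurvature_eq_zero_iff hw hnabla).symm, h⟩
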